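/- **Setting.** Let $\mathcal L=\langle P,\{\xrightarrow{a}\}_{a\in L}\rangle$ be a probabilistic labelled transition system: $P$ and $L$ are countable, each $\xrightarrow{a}$ relates states in $P$ to discrete probability distributions on $P$, and $\{d\mid p\xrightarrow{a}d\}$ is countable for all $p,a$; $\mathcal D(\mathcal L)$ is the set of all distributions that occur. Formulas are $F::=X\mid F\vee F\mid F\wedge F\mid F\odot F\mid F\cdot F\mid\langle a\rangle F\mid[a]F\mid\mu X.F\mid\nu X.F$, and $\rho$ interprets each variable by a function $P\to[0,1]$. A formula is in *product normal form* if distinct occurrences of binders bind distinct variables, no variable is both free and bound, and there is no subformula $G\cdot G$ or $G\odot G$. **The game $\mathcal G^F_\rho$.** Its states are $\langle p,G\rangle$, $\langle d,G\rangle$ with $p\in P$, $d\in\mathcal D(\mathcal L)$, $G\in Sub(F)$, and $\top,\bot$. The successors of $\langle d,G\rangle$ (Nature, moving by $d$) are the $\langle p,G\rangle$ with $d(p)>0$; those of $\langle p,\langle a\rangle H\rangle$ (Player 1) and $\langle p,[a]H\rangle$ (Player 2) are the $\langle d,H\rangle$ with $p\xrightarrow{a}d$; those of $\langle p,H\star H'\rangle$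 are $\langle p,H\rangle,\langle p,H'\rangle$ (Player 1 for $\vee$, Player 2 for $\wedge$, branching for $\odot$ and $\cdot$); the successor of $\langle p,\star X.H\rangle$, and of $\langle p,X\rangle$ if $X$ is bound in $F$ by $\star X.H$, is $\langle p,H\rangle$ (Player 1 for $\star=\mu$, Player 2 for $\star=\nu$); the successors of $\langle p,X\rangle$ with $X$ free in $F$ are $\top,\bot$ (Nature, with probabilities $\rho(X)(p)$ and $1-\rho(X)(p)$); $\top$ (Player 2) and $\bot$ (Player 1) are terminal. Priorities: terminal states have priority $0$ if they belong to Player 1 and $1$ if they belong to Player 2; $\langle p,X\rangle$ with $X$ bound in $F$ has priority $r(X)$, where $r(X)$ is odd for $\mu$-variables, even for $\nu$-variables, and $r(Z)>r(Y)$ whenever $Z$ subsumes $Y$ (i.e. the binding subformula of $Y$ is a subformula of the body of that of $Z$); all other states have priority $0$. A *branching play* is a set of finite paths, closed under non-empty prefixes, with exactly one path of length one, in which every node ending in a state of Player 1, Player 2 or Nature is either terminal or has exactly one child, and every node ending in a branching state has all its successors as children. In the inner game on a branching play $T$, a token moves from the root along a completed (terminated or infinite) path of $T$; Player 1 chooses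 the child at $\odot$-nodes, Player 2 at $\cdot$-nodes. Player 1 wins a terminated path if its last state has odd priority, and an infinite path if the greatest priority occurring infinitely often is even. Let $\mathcal{BP}^F$ be the set of all branching plays of $\mathcal G^F_\rho$ and $\Phi^F\subseteq\mathcal{BP}^F$ the set of those in whose inner game Player 1 has a winning strategy. **The operator $\mathbb W$.** Let $\star\in\{\mu,\nu\}$, let $\star X.F$ be in product normal form, and use the same priority function $r$, admissible for $\star X.F$, in the games for $\star X.F$ and for $F$. Given $\mathcal Y\subseteq\mathcal{BP}^{\star X.F}$, define $m_{\mathcal Y}:\mathcal{BP}^{\star X.F}\to\mathcal{BP}^{F}$ as follows. If the root of $T$ is $\langle p,X\rangle$, $\langle p,\star X.F\rangle$ or $\langle d,\star X.F\rangle$, then $T$ starts with a non-branching path, of length one or two, from the root to a state $\langle q,F\rangle$; let $T'$ be the subtree of $T$ rooted at this $\langle q,F\rangle$. Otherwise let $T'=T$. Let $\vec s_i$ ($i\in I$) be the nodes of $T'$ that end in a state of the form $\langle p_i,X\rangle$ and have no earlier state of this form, and let $T_i$ be the subtree of $T'$ at $\vec s_i$, a branching play rooted at $\langle p_i,X\rangle$.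 Then $m_{\mathcal Y}(T)$ is obtained from $T'$ by replacing, for each $i$, the subtree $T_i$ by the tree $\langle p_i,X\rangle\to\top$ if $T_i\in\mathcal Y$, and by the tree $\langle p_i,X\rangle\to\bot$ if $T_i\notin\mathcal Y$. Put $\mathbb W(\mathcal Y)=m_{\mathcal Y}^{-1}(\Phi^F)$. **Theorem.** Let $X$ be a variable, $F$ a formula, and $\rho$ an interpretation. 1. If $\mu X.F$ is in product normal form, then the operator $\mathbb W$ on subsets of $\mathcal{BP}^{\mu X.F}$ is monotone, and $\Phi^{\mu X.F}$ is its least fixed point. 2. If $\nu X.F$ is in product normal form, then the operator $\mathbb W$ on subsets of $\mathcal{BP}^{\nu X.F}$ is monotone, and $\Phi^{\nu X.F}$ is its greatest fixed point. -/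

import Mathlib

open Set Filter

/-! ## Stochastic tree games and meta-parity games -/

namespace TreeGame

/-- The two players. -/
inductive Player
  | one
  | two

/-- The block of the partition `(S₁, S₂, S_N, B)` to which a state belongs. -/
inductive Kind
  | player1
  | player2
  | nature
  | branching

/-- An arena `⟨(S, E), (S₁, S₂, S_N, B), π⟩`. The states form a countable subset `S` of an ambient
type `σ`. The values of `kind` and `π` matter only on `S` and on the states of Nature,
respectively. -/
structure Arena (σ : Type*) where
  S : Set σ
  E : σ → σ → Prop
  kind : σ → Kind
  π : σ → PMF σ
  countable_S : S.Countable
  edge_mem : ∀ s t, E s t → s ∈ S ∧ t ∈ S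
  support_π : ∀ s ∈ S, kind s = Kind.nature → (π s).support ⊆ {t | E s t}

namespace Arena

variable {σ : Type*} (A : Arena σ)

/-- A state without successors. -/
def Terminal (s : σ) : Prop := ∀ t, ¬ A.E s t

/-- A (non-empty) finite path in the arena, written from its first to its last state. -/
structure IsPath (l : List σ) : Prop where
  ne_nil : l ≠ []
  mem : ∀ s ∈ l, s ∈ A.S
  chain : l.IsChain A.E

/-- A tree in the arena: a set of finite paths which is closed under non-empty prefixes and
contains exactly one path of length one. -/
structure IsTree (T : Set (List σ)) : Prop where
  path : ∀ l ∈ T, A.IsPath l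
  down_closed : ∀ l ∈ T, ∀ t, t ≠ [] → t <+: l → t ∈ T
  root : ∃! s, [s] ∈ T

/-- A branching play: nodes ending in a state of Player 1, Player 2 or Nature branch uniquely,
nodes ending in a branching state branch fully. -/
structure IsBranchingPlay (T : Set (List σ)) : Prop extends A.IsTree T where
  unique : ∀ l s, l ++ [s] ∈ T → A.kind s ≠ Kind.branching →
    A.Terminal s ∨ ∃! t, l ++ [s, t] ∈ T
  full : ∀ l s, l ++ [s] ∈ T → A.kind s = Kind.branching → ∀ t, A.E s t → l ++ [s, t] ∈ T

/-- The set `BP` of branching plays of the arena. -/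
def BP : Type _ := {T : Set (List σ) // A.IsBranchingPlay T}

end Arena

/-- A finite or infinite sequence of states. -/
inductive CompletedPath (σ : Type*)
  | fin (l : List σ)
  | inf (x : ℕ → σ)

namespace CompletedPath

variable {σ : Type*}

/-- The non-empty finite prefixes of a finite or infinite sequence. -/
def prefixes : CompletedPath σ → Set (List σ)
  | fin l => {u | u ≠ [] ∧ u <+: l}
  | inf x => {u | ∃ n : ℕ, u = (List.range (n + 1)).map x}

/-- The completed paths of an arena: finite paths ending in a terminal state, and infinite
paths. -/
def IsIn (A : Arena σ) : CompletedPath σ → Prop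
  | fin l => A.IsPath l ∧ ∃ u s, l = u ++ [s] ∧ A.Terminal s
  | inf x => (∀ n, x n ∈ A.S) ∧ ∀ n, A.E (x n) (x (n + 1))

end CompletedPath

/-- The data of a two-player stochastic meta-parity game: an arena, a parity assignment `Ω` taking
finitely many values, and a player assignment `Pl` (which matters on branching states only). -/
structure MetaParityGame (σ : Type*) extends Arena σ where
  Ω : σ → ℕ
  Pl : σ → Player
  finite_Ω : (Ω '' S).Finite

namespace MetaParityGame

variable {σ : Type*} (G : MetaParityGame σ)

/-- The parity set `W_Ω`. A finite completed path belongs to it if the priority of its last state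
is odd, an infinite one if the greatest priority occurring infinitely often is even. -/
def paritySet : Set (CompletedPath σ) :=
  {c | match c with
    | .fin l => ∃ u s, l = u ++ [s] ∧ Odd (G.Ω s)
    | .inf x => ∃ k, IsGreatest {j | ∃ᶠ n in atTop, G.Ω (x n) = j} k ∧ Even k}

/-- `τ` is a strategy for Player `i` in the inner game `G_T`: at every node of `T` which ends in a
non-terminal branching state of Player `i`, it selects a child of that node in `T`. -/
def IsStrategy (T : Set (List σ)) (i : Player) (τ : List σ → σ) : Prop :=
  ∀ l s, l ++ [s] ∈ T → G.kind s = Kind.branching → G.Pl s = i → ¬ G.Terminal s →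
    l ++ [s, τ (l ++ [s])] ∈ T

/-- The play `c` is consistent with the strategy `τ` of Player `i`. -/
def Consistent (i : Player) (τ : List σ → σ) (c : CompletedPath σ) : Prop :=
  ∀ l s t, l ++ [s, t] ∈ c.prefixes → G.kind s = Kind.branching → G.Pl s = i →
    t = τ (l ++ [s])

/-- Player 1 has a winning strategy in the inner parity game `G_T` played on the tree `T`. A play
of `G_T` is a completed path all of whose prefixes are nodes of `T`. -/
def PlayerOneWins (T : Set (List σ)) : Prop :=
  ∃ τ : List σ → σ, G.IsStrategy T Player.one τ ∧
    ∀ c : CompletedPath σ, c.IsIn G.toArena → c.prefixes ⊆ T →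
      G.Consistent Player.one τ c → c ∈ G.paritySet

/-- The winning set `Φ`: the branching plays `T` such that Player 1 has a winning strategy in the
inner game `G_T`. -/
def Φ : Set G.BP := {T | G.PlayerOneWins T.1}

end MetaParityGame

namespace Arena.BP

variable {σ : Type*} {A : Arena σ}

/-- The subtree of a branching play at one of its nodes `u ++ [s]`, as a branching play rooted
at `s`. -/
def subtree (T : A.BP) (u : List σ) (s : σ) (h : u ++ [s] ∈ T.1) : A.BP :=
  ⟨{t | t.head? = some s ∧ u ++ t ∈ T.1}, by
    obtain ⟨T, hT⟩ := T
    refine ⟨⟨?_, ?_, ?_⟩, ?_, ?_⟩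
    · rintro l ⟨hl, hl'⟩
      have hp := hT.path _ hl'
      refine ⟨?_, fun s hs => hp.mem s (by simp [hs]), hp.chain.right_of_append⟩
      rintro rfl
      simp at hl
    · rintro l ⟨hl, hl'⟩ t ht ⟨r, rfl⟩
      refine ⟨?_, hT.down_closed _ hl' _ (by simp [ht]) ⟨r, by simp⟩⟩
      cases t with
      | nil => exact absurd rfl ht
      | cons a t => simpa using hl
    · refine ⟨s, ⟨by simp, h⟩, ?_⟩
      rintro y ⟨hy, -⟩
      simpa using hy
    · rintro l r ⟨hl, hl'⟩ hk
      refine (hT.unique (u ++ l) r (by simpa using hl') hk).imp id ?_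
      rintro ⟨t, ht, hu⟩
      refine ⟨t, ⟨?_, by simpa using ht⟩, fun y hy => hu y (by simpa using hy.2)⟩
      cases l <;> simpa using hl
    · rintro l r ⟨hl, hl'⟩ hk t ht
      refine ⟨?_, by simpa using hT.full (u ++ l) r (by simpa using hl') hk t ht⟩
      cases l <;> simpa using hl⟩

end Arena.BP

end TreeGame

/-! ## The logic and its games -/

namespace PLMu

open TreeGame

/-- A probabilistic labelled transition system with labels in `L` and states in `P`: `trans a p` is
the (countable) set of the distributions `d` with `p -a→ d`. -/
structure PLTS (L P : Type*) where
  trans : L → P → Set (PMF P)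
  countable_trans : ∀ a p, (trans a p).Countable

/-- The set `D(𝓛)` of the probability distributions of the system. -/
def PLTS.dists {L P : Type*} (𝓛 : PLTS L P) : Set (PMF P) := ⋃ a, ⋃ p, 𝓛.trans a p

/-- The binary connectives `∨`, `∧`, `⊙` and `·`. -/
inductive Conn
  | or
  | and
  | coprod
  | prod

/-- The modalities `⟨a⟩` and `[a]`. -/
inductive Modality
  | dia
  | box

/-- The fixed point binders `μ` and `ν`. -/
inductive Binder
  | mu
  | nu

/-- Formulas with variables in `V` and labels in `L`. -/
inductive Formula (V L : Type*)
  | var (X : V)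
  | conn (o : Conn) (F G : Formula V L)
  | modal (m : Modality) (a : L) (F : Formula V L)
  | fix (b : Binder) (X : V) (F : Formula V L)

namespace Formula

variable {V L : Type*}

/-- The set of subformulas. -/
def Sub : Formula V L → Set (Formula V L)
  | var X => {var X}
  | conn o F G => {conn o F G} ∪ (F.Sub ∪ G.Sub)
  | modal m a F => {modal m a F} ∪ F.Sub
  | fix b X F => {fix b X F} ∪ F.Sub

/-- The set of free variables. -/
def free : Formula V L → Set V
  | var X => {X}
  | conn _ F G => F.free ∪ G.free
  | modal _ _ F => F.free
  | fix _ X F => F.free \ {X}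

/-- The list of the variables bound by the occurrences of binders. -/
def binders : Formula V L → List V
  | var _ => []
  | conn _ F G => F.binders ++ G.binders
  | modal _ _ F => F.binders
  | fix _ X F => X :: F.binders

/-- Normal form: distinct occurrences of binders bind distinct variables, and no variable is both
free and bound. -/
def IsNormal (F : Formula V L) : Prop := F.binders.Nodup ∧ ∀ X ∈ F.free, X ∉ F.binders

/-- Product normal form: normal form without subformulas `G · G` and `G ⊙ G`. -/
def IsProductNormal (F : Formula V L) : Prop :=
  F.IsNormal ∧ ∀ G, conn Conn.prod G G ∉ F.Sub ∧ conn Conn.coprod G G ∉ F.Sub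

/-- `X` subsumes `Y` in `F`: they are bound by subformulas `⋆₁X.G` and `⋆₂Y.H` of `F` such that
`⋆₂Y.H` is a subformula of `G`. -/
def Subsumes (F : Formula V L) (X Y : V) : Prop :=
  ∃ b G c H, fix b X G ∈ F.Sub ∧ fix c Y H ∈ F.Sub ∧ fix c Y H ∈ G.Sub

/-- Admissible priorities for the bound variables of `F`: odd for `μ`-variables, even for
`ν`-variables, and strictly decreasing along subsumption. -/
structure IsPriority (F : Formula V L) (r : V → ℕ) : Prop where
  odd : ∀ X G, fix Binder.mu X G ∈ F.Sub → Odd (r X)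
  even : ∀ X G, fix Binder.nu X G ∈ F.Sub → Even (r X)
  lt : ∀ Z Y, F.Subsumes Z Y → r Y < r Z

theorem mem_Sub_self (F : Formula V L) : F ∈ F.Sub := by
  cases F <;> simp [Sub]

theorem Sub_trans {F G : Formula V L} (h : G ∈ F.Sub) : G.Sub ⊆ F.Sub := by
  induction F with
  | var X => simp only [Sub, mem_singleton_iff] at h; subst h; exact subset_rfl
  | conn o F₁ F₂ h₁ h₂ =>
    rcases h with h | h | h
    · rw [mem_singleton_iff.1 h]
    · exact fun x hx => Or.inr (Or.inl (h₁ h hx))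
    · exact fun x hx => Or.inr (Or.inr (h₂ h hx))
  | modal m a F₁ h₁ =>
    rcases h with h | h
    · rw [mem_singleton_iff.1 h]
    · exact fun x hx => Or.inr (h₁ h hx)
  | fix b X F₁ h₁ =>
    rcases h with h | h
    · rw [mem_singleton_iff.1 h]
    · exact fun x hx => Or.inr (h₁ h hx)

theorem finite_Sub (F : Formula V L) : F.Sub.Finite := by
  induction F with
  | var X => exact finite_singleton _
  | conn o F₁ F₂ h₁ h₂ => exact (finite_singleton _).union (h₁.union h₂)
  | modal m a F₁ h₁ => exact (finite_singleton _).union h₁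
  | fix b X F₁ h₁ => exact (finite_singleton _).union h₁

theorem conn_mem {F : Formula V L} {o H H'} (h : conn o H H' ∈ F.Sub) :
    H ∈ F.Sub ∧ H' ∈ F.Sub :=
  ⟨Sub_trans h (Or.inr (Or.inl (mem_Sub_self H))), Sub_trans h (Or.inr (Or.inr (mem_Sub_self H')))⟩

theorem modal_mem {F : Formula V L} {m a H} (h : modal m a H ∈ F.Sub) : H ∈ F.Sub :=
  Sub_trans h (Or.inr (mem_Sub_self H))

theorem fix_mem {F : Formula V L} {b X H} (h : fix b X H ∈ F.Sub) : H ∈ F.Sub :=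
  Sub_trans h (Or.inr (mem_Sub_self H))

theorem mem_binders {F : Formula V L} {b X H} (h : fix b X H ∈ F.Sub) : X ∈ F.binders := by
  induction F with
  | var Y => simp [Sub] at h
  | conn o F₁ F₂ h₁ h₂ =>
    simp only [Sub, mem_union, mem_singleton_iff, reduceCtorEq, false_or] at h
    simp only [binders, List.mem_append]
    exact h.imp h₁ h₂
  | modal m a F₁ h₁ =>
    simp only [Sub, mem_union, mem_singleton_iff, reduceCtorEq, false_or] at h
    exact h₁ h
  | fix c Y F₁ h₁ =>
    simp only [Sub, mem_union, mem_singleton_iff, fix.injEq] at h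
    simp only [binders, List.mem_cons]
    exact h.imp (fun h => h.2.1) h₁

theorem free_or_binders {F : Formula V L} {X} (h : var X ∈ F.Sub) : X ∈ F.free ∨ X ∈ F.binders := by
  induction F with
  | var Y => simp [Sub] at h; simp [free, h]
  | conn o F₁ F₂ h₁ h₂ =>
    simp only [Sub, mem_union, mem_singleton_iff, reduceCtorEq, false_or] at h
    simp only [free, binders, mem_union, List.mem_append]
    rcases h with h | h
    · have := h₁ h; tauto
    · have := h₂ h; tauto
  | modal m a F₁ h₁ =>
    simp only [Sub, mem_union, mem_singleton_iff, reduceCtorEq, false_or] at h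
    exact h₁ h
  | fix c Y F₁ h₁ =>
    simp only [Sub, mem_union, mem_singleton_iff, reduceCtorEq, false_or] at h
    simp only [free, binders, Set.mem_sdiff, mem_singleton_iff, List.mem_cons]
    have := h₁ h
    tauto

end Formula

/-- Game states: `⟨p, G⟩`, `⟨d, G⟩`, `⊤` and `⊥`. -/
inductive State (V L P : Type*)
  | node (p : P) (G : Formula V L)
  | distr (d : PMF P) (G : Formula V L)
  | top
  | bot

section Game

variable {V L P : Type*} (𝓛 : PLTS L P) (ρ : V → P → unitInterval)

open Formula State

/-- The states of the game for `F`. -/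
def states (F : Formula V L) : Set (State V L P) :=
  {s | match s with
    | node _ G => G ∈ F.Sub
    | distr d G => d ∈ 𝓛.dists ∧ G ∈ F.Sub
    | top => True
    | bot => True}

/-- The successors of a state in the game for `F`. -/
def succ (F : Formula V L) : State V L P → Set (State V L P)
  | node p (var X) => {t | (X ∈ F.free ∧ (t = bot ∨ t = top)) ∨
      ∃ b H, fix b X H ∈ F.Sub ∧ t = node p H}
  | node p (fix _ _ H) => {node p H}
  | node p (modal _ a H) => {t | ∃ d ∈ 𝓛.trans a p, t = distr d H}
  | node p (conn _ H H') => {node p H, node p H'}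
  | distr d G => {t | ∃ p ∈ d.support, t = node p G}
  | top => ∅
  | bot => ∅

open Classical in
/-- The partition of the states of the game for `F`. -/
noncomputable def kind (F : Formula V L) : State V L P → Kind
  | node _ (var X) => if X ∈ F.free then Kind.nature
      else if ∃ H, fix Binder.mu X H ∈ F.Sub then Kind.player1 else Kind.player2
  | node _ (fix Binder.mu _ _) => Kind.player1
  | node _ (fix Binder.nu _ _) => Kind.player2
  | node _ (modal Modality.dia _ _) => Kind.player1
  | node _ (modal Modality.box _ _) => Kind.player2
  | node _ (conn Conn.or _ _) => Kind.player1
  | node _ (conn Conn.and _ _) => Kind.player2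
  | node _ (conn Conn.coprod _ _) => Kind.branching
  | node _ (conn Conn.prod _ _) => Kind.branching
  | distr _ _ => Kind.nature
  | top => Kind.player2
  | bot => Kind.player1

/-- The distribution with mass `x` at `⊤` and `1 - x` at `⊥`. -/
noncomputable def coin (x : unitInterval) : PMF (State V L P) :=
  (PMF.ofFintype (fun b : Bool => ENNReal.ofReal (if b then (x : ℝ) else 1 - x)) (by
    have h0 := x.2.1
    have h1 := x.2.2
    rw [Fintype.sum_bool, ← ENNReal.ofReal_add] <;> simp [h0, h1])).map
    (fun b => if b then top else bot)

/-- The moves of Nature; the last case is irrelevant. -/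
noncomputable def move : State V L P → PMF (State V L P)
  | node p (var X) => coin (ρ X p)
  | distr d G => d.map fun p => node p G
  | s => PMF.pure s

open Classical in
/-- The priorities in the game for `F`, where `r` gives the priorities of the bound variables. -/
noncomputable def priority (F : Formula V L) (r : V → ℕ) (s : State V L P) : ℕ :=
  if s ∈ states 𝓛 F ∧ succ 𝓛 F s = ∅ then
    match kind F s with
    | Kind.player2 => 1
    | _ => 0
  else
    match s with
    | node _ (var X) => if ∃ b H, fix b X H ∈ F.Sub then r X else 0
    | _ => 0

/-- The player assignment: `⊙`-states belong to Player 1, `·`-states to Player 2. -/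
def player : State V L P → Player
  | node _ (conn Conn.coprod _ _) => Player.one
  | _ => Player.two

variable {𝓛}

theorem succ_mem {F : Formula V L} {s t : State V L P} (hs : s ∈ states 𝓛 F)
    (ht : t ∈ succ 𝓛 F s) : t ∈ states 𝓛 F := by
  cases s with
  | node p G =>
    have hG : G ∈ F.Sub := hs
    cases G with
    | var X =>
      rcases ht with ⟨-, rfl | rfl⟩ | ⟨b, H, hH, rfl⟩
      · trivial
      · trivial
      · exact fix_mem hH
    | conn o H H' =>
      rcases ht with rfl | rfl
      · exact (conn_mem hG).1
      · exact (conn_mem hG).2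
    | modal m a H =>
      obtain ⟨d, hd, rfl⟩ := ht
      exact ⟨mem_iUnion.2 ⟨a, mem_iUnion.2 ⟨p, hd⟩⟩, modal_mem hG⟩
    | fix b X H =>
      rw [mem_singleton_iff.1 ht]
      exact fix_mem hG
  | distr d G =>
    obtain ⟨p, -, rfl⟩ := ht
    exact hs.2
  | top => exact absurd ht (by simp [succ])
  | bot => exact absurd ht (by simp [succ])

theorem countable_states [Countable L] [Countable P] (F : Formula V L) :
    (states (V := V) 𝓛 F).Countable := by
  have hd : 𝓛.dists.Countable :=
    countable_iUnion fun a => countable_iUnion fun p => 𝓛.countable_trans a p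
  have h1 := (((countable_univ : (univ : Set P).Countable).prod F.finite_Sub.countable).image
    (fun x => (node x.1 x.2 : State V L P)))
  have h2 := ((hd.prod F.finite_Sub.countable).image (fun x => (distr x.1 x.2 : State V L P)))
  refine ((h1.union h2).union ((countable_singleton top).union (countable_singleton bot))).mono ?_
  rintro s hs
  cases s with
  | node p G => exact Or.inl (Or.inl ⟨(p, G), ⟨trivial, hs⟩, rfl⟩)
  | distr d G => exact Or.inl (Or.inr ⟨(d, G), hs, rfl⟩)
  | top => exact Or.inr (Or.inl rfl)
  | bot => exact Or.inr (Or.inr rfl)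

variable (𝓛)

/-- The game for the formula `F` under the interpretation `ρ`, where `r` gives the priorities of the
bound variables. -/
noncomputable def game [Countable L] [Countable P] (F : Formula V L) (r : V → ℕ) :
    MetaParityGame (State V L P) where
  S := states 𝓛 F
  E s t := s ∈ states 𝓛 F ∧ t ∈ succ 𝓛 F s
  kind := kind F
  π := move ρ
  countable_S := countable_states F
  edge_mem _ _ h := ⟨h.1, succ_mem h.1 h.2⟩
  support_π s hs hk t ht := by
    refine ⟨hs, ?_⟩
    rcases s with ⟨p, (X | ⟨_ | _ | _ | _, H, H'⟩ | ⟨_ | _, a, H⟩ | ⟨_ | _, X, H⟩)⟩ | ⟨d, G⟩ | _ | _ <;>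
      simp only [kind, reduceCtorEq] at hk
    · have hX : X ∈ F.free := by
        by_contra hX
        rw [if_neg hX] at hk
        split_ifs at hk
      simp only [move, coin, PMF.mem_support_map_iff] at ht
      obtain ⟨b, -, rfl⟩ := ht
      cases b <;> simp [succ, hX]
    · simp only [move, PMF.mem_support_map_iff] at ht
      obtain ⟨q, hq, rfl⟩ := ht
      exact ⟨q, hq, rfl⟩
  Ω := priority 𝓛 F r
  Pl := player
  finite_Ω := by
    have hf : ((fun G : Formula V L => match G with | var X => r X | _ => 0) '' F.Sub).Finite :=
      F.finite_Sub.image _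
    refine (hf.union ((finite_singleton 0).union (finite_singleton 1))).subset ?_
    rintro n ⟨s, hs, rfl⟩
    unfold priority
    split_ifs with h
    · split
      · exact Or.inr (Or.inr rfl)
      · exact Or.inr (Or.inl rfl)
    · split
      · rename_i p Y
        split_ifs
        · exact Or.inl ⟨var Y, hs, rfl⟩
        · exact Or.inr (Or.inl rfl)
      · exact Or.inr (Or.inl rfl)

/-! ### The operator on sets of branching plays -/

/-- States of the form `⟨p, X⟩`. -/
def IsHole (X : V) (s : State V L P) : Prop := ∃ p, s = node p (var X)

variable {𝓛}

theorem succ_eq {b : Binder} {X : V} {F : Formula V L} {s : State V L P} (hX : ¬ IsHole X s) :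
    succ 𝓛 (fix b X F) s = succ 𝓛 F s ∧ kind (fix b X F) s = kind F s := by
  rcases s with ⟨p, (Y | ⟨_ | _ | _ | _, H, H'⟩ | ⟨_ | _, a, H⟩ | ⟨_ | _, Y, H⟩)⟩ | ⟨d, G⟩ | _ | _
  · have hY : Y ≠ X := by
      rintro rfl
      exact hX ⟨p, rfl⟩
    have e : ∀ c H, fix c Y H ∈ (fix b X F).Sub ↔ fix c Y H ∈ F.Sub := by
      intro c H
      simp [Formula.Sub, hY]
    have e' : Y ∈ (fix b X F).free ↔ Y ∈ F.free := by
      simp [Formula.free, hY]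
    constructor
    · simp only [succ, e, e']
    · classical
      simp only [kind]
      exact if_congr e' rfl (if_congr (exists_congr fun H => e _ H) rfl rfl)
  all_goals exact ⟨rfl, by simp only [kind]⟩

theorem succ_mem_of_succ_fix {b : Binder} {X : V} {F : Formula V L} {s t : State V L P}
    (hs : s ∈ states 𝓛 F) (ht : t ∈ succ 𝓛 (fix b X F) s) : t ∈ states 𝓛 F := by
  by_cases hX : IsHole X s
  · obtain ⟨p, rfl⟩ := hX
    rcases ht with ⟨-, rfl | rfl⟩ | ⟨c, H, hH, rfl⟩
    · trivial
    · trivial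
    · rcases hH with hH | hH
      · obtain ⟨-, -, rfl⟩ := Formula.fix.inj (mem_singleton_iff.1 hH)
        exact mem_Sub_self H
      · exact fix_mem hH
  · rw [(succ_eq hX).1] at ht
    exact succ_mem hs ht

variable (𝓛)

/-- The tree obtained from `T` by replacing, for each path `l.⟨p, X⟩` of `T` reaching a state of the
form `⟨p, X⟩` for the first time, the subtree of `T` at this node by the tree with root `⟨p, X⟩` and
the leaf `b l ⟨p, X⟩` as the only child of the root. -/
def fill (X : V) (T : Set (List (State V L P)))
    (b : (l : List (State V L P)) → (s : State V L P) → l ++ [s] ∈ T → State V L P) :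
    Set (List (State V L P)) :=
  {l | l ∈ T ∧ ∀ s ∈ l.dropLast, ¬ IsHole X s} ∪
    {l' | ∃ l s, ∃ h : l ++ [s] ∈ T, IsHole X s ∧ (∀ s' ∈ l, ¬ IsHole X s') ∧
      l' = l ++ [s, b l s h]}

/-- The finite paths which lead, in the game for `⋆X.F`, to a first unfolding `⟨p, F⟩` from a state
that is not a state of the game for `F` or is of the form `⟨p, X⟩`. -/
inductive IsEntry (b : Binder) (X : V) (F : Formula V L) : List (State V L P) → Prop
  | var (p : P) : IsEntry b X F [node p (var X)]
  | fix (p : P) : IsEntry b X F [node p (fix b X F)]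
  | distr (d : PMF P) (p : P) : IsEntry b X F [distr d (fix b X F), node p (fix b X F)]

variable [Countable L] [Countable P] {b : Binder} {X : V} {F : Formula V L} {r : V → ℕ}

open Classical in
/-- A branching play of the game for `⋆X.F` whose root is `⟨p, X⟩`, `⟨p, ⋆X.F⟩` or `⟨d, ⋆X.F⟩` begins
with a non-branching path to a state `⟨p, F⟩`; `unfoldRoot` deletes the part of this path that
precedes `⟨p, F⟩`. Other branching plays are left unchanged. -/
noncomputable def unfoldRoot (T : (game 𝓛 ρ (fix b X F) r).BP) : (game 𝓛 ρ (fix b X F) r).BP :=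
  if h : ∃ u p, IsEntry b X F u ∧ u ++ [node p F] ∈ T.1 then
    T.subtree h.choose (node h.choose_spec.choose F) h.choose_spec.choose_spec.2
  else T

open Classical in
/-- The leaf `⊤` if the branching play belongs to `Y`, and the leaf `⊥` otherwise. -/
noncomputable def leaf (Y : Set (game 𝓛 ρ (fix b X F) r).BP)
    (T : (game 𝓛 ρ (fix b X F) r).BP) : State V L P :=
  if T ∈ Y then top else bot

variable {𝓛 ρ}

theorem edge_congr {s t : State V L P} (hs : s ∈ states 𝓛 F) (hX : ¬ IsHole X s) :
    (game 𝓛 ρ (fix b X F) r).E s t ↔ (game 𝓛 ρ F r).E s t := by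
  have h : s ∈ states 𝓛 (fix b X F) := by
    cases s with
    | node p G => exact Or.inr hs
    | distr d G => exact ⟨hs.1, Or.inr hs.2⟩
    | top => trivial
    | bot => trivial
  simp only [game, hs, h, true_and, (succ_eq (b := b) hX).1]

theorem mem_of_root (T : (game 𝓛 ρ (fix b X F) r).BP)
    (hT : ∀ s, [s] ∈ T.1 → s ∈ states 𝓛 F) : ∀ l ∈ T.1, ∀ s ∈ l, s ∈ states 𝓛 F := by
  intro l
  induction l using List.reverseRecOn with
  | nil => simp
  | append_singleton l a ih =>
    intro hl s hs
    rcases List.eq_nil_or_concat' l with rfl | ⟨u, c, rfl⟩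
    · simp only [List.nil_append, List.mem_singleton] at hs
      subst hs
      exact hT s hl
    · have h1 := ih (T.2.down_closed _ hl _ (by simp) ⟨[a], rfl⟩)
      rcases List.mem_append.1 hs with hs | hs
      · exact h1 s hs
      · rw [List.mem_singleton.1 hs]
        have hE : (game 𝓛 ρ (fix b X F) r).E c a := by
          have := (T.2.path _ hl).chain
          rw [List.append_assoc, List.singleton_append, List.isChain_append_cons_cons] at this
          exact this.2.1
        exact succ_mem_of_succ_fix (h1 c (by simp)) hE.2

/-- A node which ends in a non-terminal state other than a branching one has a child. -/
theorem exists_child {σ : Type*} {A : Arena σ} (T : A.BP) {l : List σ} {s t : σ}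
    (h : l ++ [s] ∈ T.1) (hk : A.kind s ≠ Kind.branching) (ht : A.E s t) :
    ∃ t', A.E s t' ∧ l ++ [s, t'] ∈ T.1 := by
  rcases T.2.unique l s h hk with h' | ⟨t', h', -⟩
  · exact absurd ht (h' t)
  · have := (T.2.path _ h').chain
    rw [List.isChain_append_cons_cons] at this
    exact ⟨t', this.2.1, h'⟩

/-- After unfolding the root, all states occurring in the tree are states of the game for `F`. -/
theorem unfoldRoot_mem (T : (game 𝓛 ρ (fix b X F) r).BP) :
    ∀ l ∈ (unfoldRoot 𝓛 ρ T).1, ∀ s ∈ l, s ∈ states 𝓛 F := by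
  apply mem_of_root
  unfold unfoldRoot
  split_ifs with h
  · rintro s ⟨hs, -⟩
    simp only [List.head?_cons, Option.some.injEq] at hs
    rw [hs]
    exact mem_Sub_self F
  · intro s hs
    have hs' : s ∈ states 𝓛 (fix b X F) := (T.2.path _ hs).mem s (by simp)
    have key : ∀ u p, IsEntry b X F (u ++ [node p (fix b X F)]) →
        u ++ [node p (fix b X F)] ∈ T.1 → False := by
      intro u p hu hT
      have hk : kind (fix b X F) (node p (fix b X F) : State V L P) ≠ Kind.branching := by
        cases b <;> simp [kind]
      obtain ⟨t, ht, ht'⟩ := exists_child T (t := node p F) hT hk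
        ⟨(T.2.path _ hT).mem _ (by simp), rfl⟩
      have e : t = node p F := ht.2
      subst e
      exact h ⟨_, p, hu, by simpa using ht'⟩
    rcases s with ⟨p, G⟩ | ⟨d, G⟩ | _ | _
    · rcases hs' with e | hG
      · rw [mem_singleton_iff] at e
        subst e
        exact (key [] p (IsEntry.fix p) hs).elim
      · exact hG
    · refine ⟨hs'.1, ?_⟩
      rcases hs'.2 with e | hG
      · rw [mem_singleton_iff] at e
        subst e
        obtain ⟨p, hp⟩ := d.support_nonempty
        obtain ⟨t, ht, ht'⟩ := exists_child T (l := []) (t := node p (fix b X F)) hs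
          (by simp [game, kind]) ⟨hs', p, hp, rfl⟩
        obtain ⟨q, hq, rfl⟩ := ht.2
        exact (key [distr d (fix b X F)] q (IsEntry.distr d q) ht').elim
      · exact hG
    · trivial
    · trivial

/-- The filled tree is a branching play of the game for `F`. -/
theorem fill_isBranchingPlay (hn : (fix b X F).IsNormal) (T : (game 𝓛 ρ (fix b X F) r).BP)
    (hT : ∀ l ∈ T.1, ∀ s ∈ l, s ∈ states 𝓛 F) (c : ∀ l s, l ++ [s] ∈ T.1 → State V L P)
    (hc : ∀ l s h, c l s h = top ∨ c l s h = bot) :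
    (game 𝓛 ρ F r).IsBranchingPlay (fill X T.1 c) := by
  have hole : ∀ p, (node p (var X) : State V L P) ∈ states 𝓛 F →
      kind F (node p (var X) : State V L P) = Kind.nature ∧
      ∀ t, (t = top ∨ t = bot) → (game 𝓛 ρ F r).E (node p (var X)) t := by
    intro p hp
    have hX : X ∈ F.free := (free_or_binders hp).resolve_right (List.nodup_cons.1 hn.1).1
    exact ⟨by simp [kind, hX], fun t ht => ⟨hp, Or.inl ⟨hX, ht.symm⟩⟩⟩
  have term : ∀ t : State V L P, (t = top ∨ t = bot) →
      t ∈ states 𝓛 F ∧ (game 𝓛 ρ F r).Terminal t ∧ (game 𝓛 ρ F r).kind t ≠ Kind.branching := by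
    rintro t (rfl | rfl)
    · exact ⟨trivial, fun t h => h.2, by simp [game, kind]⟩
    · exact ⟨trivial, fun t h => h.2, by simp [game, kind]⟩
  have path : ∀ l ∈ T.1, (∀ s ∈ l.dropLast, ¬ IsHole X s) → (game 𝓛 ρ F r).IsPath l := by
    intro l hl hh
    have hp := T.2.path l hl
    refine ⟨hp.ne_nil, hT l hl, ?_⟩
    rw [List.isChain_iff_forall_rel_of_append_cons_cons]
    intro s t l₁ l₂ e
    have hE := (List.isChain_iff_forall_rel_of_append_cons_cons.1 hp.chain) e
    exact (edge_congr (hT l hl s (by simp [e])) (hh s (by simp [e]))).1 hE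
  have child : ∀ l s, l ++ [s] ∈ T.1 → (∀ s ∈ l, ¬ IsHole X s) → ¬ IsHole X s →
      ∀ t, l ++ [s, t] ∈ fill X T.1 c ↔ l ++ [s, t] ∈ T.1 := by
    intro l s hl hh hs t
    constructor
    · rintro (h | ⟨l', s', h, hs', -, e⟩)
      · exact h.1
      · have e' : l = l' ∧ s = s' ∧ t = c l' s' h := by simpa using List.append_inj' e rfl
        exact (hs (e'.2.1 ▸ hs')).elim
    · intro h
      refine Or.inl ⟨h, ?_⟩
      have e : (l ++ [s, t]).dropLast = l ++ [s] := by simp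
      rw [e]
      simp only [List.mem_append, List.mem_singleton]
      rintro x (hx | rfl)
      · exact hh x hx
      · exact hs
  refine ⟨⟨?_, ?_, ?_⟩, ?_, ?_⟩
  · rintro l (⟨hl, hh⟩ | ⟨l, s, h, hs, hh, rfl⟩)
    · exact path l hl hh
    · have hp := path _ h (by simpa using hh)
      have ht := term _ (hc l s h)
      obtain ⟨p, rfl⟩ := hs
      refine ⟨by simp, ?_, ?_⟩
      · intro x hx
        simp only [List.mem_append, List.mem_cons, List.not_mem_nil, or_false] at hx
        rcases hx with hx | rfl | rfl
        · exact hp.mem x (by simp [hx])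
        · exact hp.mem _ (by simp)
        · exact ht.1
      · rw [List.isChain_append_cons_cons]
        exact ⟨hp.chain, (hole p (hp.mem _ (by simp))).2 _ (hc l _ h), by simp⟩
  · have pre : ∀ l ∈ T.1, (∀ s ∈ l.dropLast, ¬ IsHole X s) → ∀ t, t ≠ [] → t <+: l →
        t ∈ fill X T.1 c := by
      intro l hl hh t ht htl
      refine Or.inl ⟨T.2.down_closed l hl t ht htl, fun s hs => hh s ?_⟩
      obtain ⟨w, rfl⟩ := htl
      rcases List.eq_nil_or_concat' w with rfl | ⟨w, a, rfl⟩
      · simpa using hs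
      · rw [← List.append_assoc, List.dropLast_concat]
        exact List.mem_append_left _ (List.mem_of_mem_dropLast hs)
    rintro l (⟨hl, hh⟩ | ⟨l, s, h, hs, hh, rfl⟩) t ht htl
    · exact pre l hl hh t ht htl
    · have e : l ++ [s, c l s h] = (l ++ [s]) ++ [c l s h] := by simp
      rw [e, List.prefix_concat_iff] at htl
      rcases htl with rfl | htl
      · exact Or.inr ⟨l, s, h, hs, hh, by simp⟩
      · exact pre _ h (by simpa using hh) t ht htl
  · obtain ⟨s, hs, hu⟩ := T.2.root
    refine ⟨s, Or.inl ⟨hs, by simp⟩, ?_⟩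
    rintro y (hy | ⟨l, s', h, -, -, e⟩)
    · exact hu y hy.1
    · have := congrArg List.length e
      simp at this
  · rintro l s (⟨hl, hh⟩ | ⟨l', s', h, hs, hh, e⟩) hk
    · have hh' : ∀ s ∈ l, ¬ IsHole X s := by simpa using hh
      by_cases hs : IsHole X s
      · refine Or.inr ⟨c l s hl, Or.inr ⟨l, s, hl, hs, hh', rfl⟩, ?_⟩
        rintro t (⟨-, ht⟩ | ⟨l', s', h, hs', -, e⟩)
        · exact (ht s (by simp) hs).elim
        · have e' : l = l' ∧ s = s' ∧ t = c l' s' h := by simpa using List.append_inj' e rfl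
          obtain ⟨rfl, rfl, rfl⟩ := e'
          rfl
      · have hS := hT _ hl s (by simp)
        rcases T.2.unique l s hl (by
          intro h
          apply hk
          rw [← h]
          exact (succ_eq (𝓛 := 𝓛) hs).2.symm) with h | h
        · exact Or.inl fun t ht => h t ((edge_congr hS hs).2 ht)
        · simp only [child l s hl hh' hs]
          exact Or.inr h
    · refine Or.inl ?_
      have e' : l ++ [s] = (l' ++ [s']) ++ [c l' s' h] := by simpa using e
      have : s = c l' s' h := by simpa using (List.append_inj' e' rfl).2
      rw [this]
      exact (term _ (hc l' s' h)).2.1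
  · rintro l s (⟨hl, hh⟩ | ⟨l', s', h, hs, hh, e⟩) hk t ht
    · have hh' : ∀ s ∈ l, ¬ IsHole X s := by simpa using hh
      have hS := hT _ hl s (by simp)
      by_cases hs : IsHole X s
      · obtain ⟨p, rfl⟩ := hs
        have := (hole p hS).1.symm.trans hk
        cases this
      · rw [child l s hl hh' hs]
        exact T.2.full l s hl ((succ_eq (𝓛 := 𝓛) hs).2.trans hk) t ((edge_congr hS hs).2 ht)
    · have e' : l ++ [s] = (l' ++ [s']) ++ [c l' s' h] := by simpa using e
      have : s = c l' s' h := by simpa using (List.append_inj' e' rfl).2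
      rw [this] at ht
      exact ((term _ (hc l' s' h)).2.1 t ht).elim

variable (𝓛 ρ)

/-- The function `m_Y` from the branching plays of the game for `⋆X.F` to those of the game for `F`:
every subtree hanging at a first occurrence of a state `⟨p, X⟩` is replaced by `⊤` if this subtree
belongs to `Y`, and by `⊥` otherwise. -/
noncomputable def m (hn : (fix b X F).IsNormal) (Y : Set (game 𝓛 ρ (fix b X F) r).BP)
    (T : (game 𝓛 ρ (fix b X F) r).BP) : (game 𝓛 ρ F r).BP :=
  ⟨fill X (unfoldRoot 𝓛 ρ T).1 fun l s h => leaf 𝓛 ρ Y ((unfoldRoot 𝓛 ρ T).subtree l s h),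
    fill_isBranchingPlay hn _ (unfoldRoot_mem T) _ fun l s h => by
      unfold leaf
      split_ifs
      · exact Or.inl rfl
      · exact Or.inr rfl⟩

/-- The operator `𝕎(Y) = m_Y⁻¹(Φ^F)` on sets of branching plays of the game for `⋆X.F`. -/
def W (hn : (fix b X F).IsNormal) (Y : Set (game 𝓛 ρ (fix b X F) r).BP) :
    Set (game 𝓛 ρ (fix b X F) r).BP :=
  m 𝓛 ρ hn Y ⁻¹' (game 𝓛 ρ F r).Φ

end Game

end PLMu

/-!
The inner games are handled through *strategy trees* (`PartialWin`): sets of nodes of a branching play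
`T` which contain the root, one child where Player 1 chooses and all children elsewhere, and all of
whose plays are won by Player 1, with the option of stopping at prescribed nodes. Player 1 wins in `T`
iff there is a strategy tree without stopping nodes (`playerOneWins_iff`). Strategy trees restrict to
subtrees (`PartialWin.subtree`), and they can be composed (`playerOneWins_of_cut`): if Player 1 has,
from each of the nodes at which `T` is cut, a strategy tree that stops at the next such nodes, and if
she wins the plays with infinitely many cuts, then she wins in `T`.

By `mem_W_iff`, `T` belongs to `𝕎(Y)` iff Player 1 has a strategy tree in `T` itself which stops at the
first states `⟨p, X⟩` after the root and reaches them only at subtrees belonging to `Y`. Indeed, the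
game for `F` differs from the one for `⋆X.F` only at the states `⟨p, X⟩`, the leaves `⊤` and `⊥` record
membership in `Y`, and unfolding the root deletes a forced initial path. Monotonicity is then evident,
and so is `Φ ⊆ 𝕎(Φ)`; the converse inclusion composes strategy trees at the first states `⟨p, X⟩`.

The variable `X` has the greatest priority in the game for `⋆X.F`, so a play through infinitely many
states `⟨p, X⟩` is decided by the parity of `r X` (`mem_paritySet_of_holes`).
* If `⋆ = ν`, such plays are won by Player 1. Given `Y ⊆ 𝕎(Y)`, the strategy trees for the members of
  `Y` compose at all the states `⟨p, X⟩`, so `Y ⊆ Φ` (`le_Φ_of_le_W`).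
* If `⋆ = μ`, such plays are lost. Given `𝕎(Y) ⊆ Y`, a strategy tree in some `T ∈ Φ` outside `Y` must
  reach a state `⟨p, X⟩` whose subtree is outside `Y`. This subtree is again won by Player 1, and
  iterating yields a play of the strategy tree through infinitely many states `⟨p, X⟩`, which is
  absurd (`Φ_le_of_W_le`).
No determinacy and no transfinite iteration are needed.
-/

namespace TreeGame

/-! ### Completed paths: prefixes, tails and extensions -/

namespace CompletedPath

variable {σ : Type*}

/-- The completed path without its first `n` states. -/
def drop (n : ℕ) : CompletedPath σ → CompletedPath σ
  | fin l => fin (l.drop n)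
  | inf x => inf fun k => x (k + n)

/-- The completed path preceded by the states of the list `v`. -/
def prepend (v : List σ) : CompletedPath σ → CompletedPath σ
  | fin l => fin (v ++ l)
  | inf x => inf fun k => if h : k < v.length then v[k] else x (k - v.length)

theorem ne_nil_of_mem_prefixes {c : CompletedPath σ} {u : List σ} (h : u ∈ c.prefixes) :
    u ≠ [] := by
  cases c with
  | fin l => exact h.1
  | inf x =>
    obtain ⟨n, rfl⟩ := h
    simp

theorem mem_prefixes_inf {x : ℕ → σ} {u : List σ} :
    u ∈ (inf x).prefixes ↔ u ≠ [] ∧ u = (List.range u.length).map x := by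
  constructor
  · rintro ⟨n, rfl⟩
    simp
  · rintro ⟨h, e⟩
    refine ⟨u.length - 1, ?_⟩
    have := List.length_pos_iff.2 h
    rw [Nat.sub_add_cancel (by omega)]
    exact e

theorem take_map_range (x : ℕ → σ) {m n : ℕ} (h : m ≤ n) :
    ((List.range n).map x).take m = (List.range m).map x := by
  rw [← List.map_take, List.take_range, min_eq_left h]

theorem mem_prefixes_of_prefix {c : CompletedPath σ} {u t : List σ} (h : u ∈ c.prefixes)
    (ht : t ≠ []) (htu : t <+: u) : t ∈ c.prefixes := by
  cases c with
  | fin l => exact ⟨ht, htu.trans h.2⟩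
  | inf x =>
    rw [mem_prefixes_inf] at h ⊢
    refine ⟨ht, ?_⟩
    have e := List.prefix_iff_eq_take.1 htu
    rw [h.2, take_map_range x htu.length_le] at e
    exact e

theorem prefix_of_length_le {c : CompletedPath σ} {u v : List σ} (hu : u ∈ c.prefixes)
    (hv : v ∈ c.prefixes) (h : u.length ≤ v.length) : u <+: v := by
  cases c with
  | fin l => exact List.prefix_of_prefix_length_le hu.2 hv.2 h
  | inf x =>
    rw [mem_prefixes_inf] at hu hv
    rw [List.prefix_iff_eq_take, hv.2, take_map_range x h]
    exact hu.2

theorem mem_prefixes_drop {c : CompletedPath σ} {v w : List σ} {s : σ}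
    (h : v ++ [s] ∈ c.prefixes) :
    w ∈ (c.drop v.length).prefixes ↔ w ≠ [] ∧ v ++ w ∈ c.prefixes := by
  cases c with
  | fin l =>
    obtain ⟨-, r, rfl⟩ := h
    simp only [drop, prefixes, mem_ofPred_eq, List.append_assoc, List.drop_left,
      List.prefix_append_right_inj, ne_eq, List.append_eq_nil_iff, and_congr_right_iff]
    tauto
  | inf x =>
    have hv : v = (List.range v.length).map x := by
      rcases eq_or_ne v [] with rfl | hv
      · rfl
      · exact (mem_prefixes_inf.1 (mem_prefixes_of_prefix h hv ⟨_, rfl⟩)).2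
    simp only [drop, mem_prefixes_inf, List.length_append, List.range_add, List.map_append,
      List.map_map]
    rw [← hv]
    have e : (x ∘ fun y => v.length + y) = fun k => x (k + v.length) := by
      funext k
      simp [add_comm]
    rw [e]
    simp only [ne_eq, List.append_eq_nil_iff, List.append_cancel_left_eq]
    tauto

theorem drop_prepend (v : List σ) (c : CompletedPath σ) :
    (c.prepend v).drop v.length = c := by
  cases c with
  | fin l => simp [drop, prepend]
  | inf x => simp [drop, prepend]

theorem prefix_or_of_mem_prefixes_prepend {c : CompletedPath σ} {u v : List σ}
    (h : u ∈ (c.prepend v).prefixes) : u <+: v ∨ ∃ w ∈ c.prefixes, u = v ++ w := by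
  cases c with
  | fin l =>
    obtain ⟨h0, h⟩ := h
    rcases List.prefix_or_prefix_of_prefix h (List.prefix_append v l) with h' | ⟨w, rfl⟩
    · exact Or.inl h'
    · have hw := (List.prefix_append_right_inj v).1 h
      rcases eq_or_ne w [] with rfl | hw0
      · exact Or.inl (by simp)
      · exact Or.inr ⟨w, ⟨hw0, hw⟩, rfl⟩
  | inf x =>
    set f : ℕ → σ := fun k => if h : k < v.length then v[k] else x (k - v.length) with hf
    have hv : (List.range v.length).map f = v := by
      refine List.ext_getElem (by simp) fun i h1 h2 => ?_
      simp [hf, h2]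
    obtain ⟨h0, e⟩ := mem_prefixes_inf.1 h
    rcases le_total u.length v.length with hl | hl
    · left
      rw [List.prefix_iff_eq_take]
      conv_rhs => rw [← hv]
      rw [take_map_range f hl]
      exact e
    · obtain ⟨k, hk⟩ := Nat.exists_eq_add_of_le hl
      have e' : u = v ++ (List.range k).map x := by
        rw [e, hk, List.range_add, List.map_append]
        change (List.range v.length).map f ++ (((List.range k).map fun y => v.length + y).map f) = _
        rw [hv, List.map_map]
        congr 2
        funext i
        simp [hf]
      rcases Nat.eq_zero_or_pos k with rfl | hk0
      · exact Or.inl (by simp [e'])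
      · exact Or.inr ⟨_, ⟨k - 1, by rw [Nat.sub_add_cancel hk0]⟩, e'⟩

theorem isIn_inf_iff {A : Arena σ} {x : ℕ → σ} :
    (inf x).IsIn A ↔ ∀ u ∈ (inf x).prefixes, A.IsPath u := by
  constructor
  · rintro ⟨h1, h2⟩ u ⟨n, rfl⟩
    refine ⟨by simp, ?_, ?_⟩
    · intro s hs
      obtain ⟨k, -, rfl⟩ := List.mem_map.1 hs
      exact h1 k
    · rw [List.isChain_iff_getElem]
      intro i hi
      simpa using h2 i
  · intro h
    refine ⟨fun n => (h _ ⟨n, rfl⟩).mem _ (List.mem_map.2 ⟨n, by simp, rfl⟩), fun n => ?_⟩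
    have := List.isChain_iff_getElem.1 (h _ ⟨n + 1, rfl⟩).chain n (by simp)
    simpa using this

theorem IsIn.isPath {A : Arena σ} {c : CompletedPath σ} (hc : c.IsIn A) {u : List σ}
    (hu : u ∈ c.prefixes) : A.IsPath u := by
  cases c with
  | fin l =>
    obtain ⟨h0, r, rfl⟩ := hu
    exact ⟨h0, fun s hs => hc.1.mem s (by simp [hs]), hc.1.chain.left_of_append⟩
  | inf x => exact isIn_inf_iff.1 hc u hu

theorem IsIn.drop {A : Arena σ} {c : CompletedPath σ} (hc : c.IsIn A) {v : List σ} {s : σ}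
    (h : v ++ [s] ∈ c.prefixes) : (c.drop v.length).IsIn A := by
  cases c with
  | fin l =>
    obtain ⟨-, r, rfl⟩ := h
    obtain ⟨hp, u, q, e, hq⟩ := hc
    simp only [CompletedPath.drop, List.append_assoc, List.drop_left]
    refine ⟨⟨by simp, fun t ht => hp.mem t ?_, ?_⟩, ?_⟩
    · simp only [List.singleton_append] at ht
      simp [List.mem_cons.1 ht]
    · have := hp.chain
      rw [List.append_assoc] at this
      exact this.right_of_append
    · rcases List.eq_nil_or_concat' r with rfl | ⟨r, a, rfl⟩
      · refine ⟨[], s, by simp, ?_⟩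
        have : q = s := by
          rw [List.append_nil] at e
          simpa using (List.append_inj' e rfl).2.symm
        exact this ▸ hq
      · refine ⟨[s] ++ r, a, by simp, ?_⟩
        have e' : (v ++ [s] ++ r) ++ [a] = u ++ [q] := by simpa using e
        have : q = a := by simpa using (List.append_inj' e' rfl).2.symm
        exact this ▸ hq
  | inf x => exact ⟨fun n => hc.1 _, fun n => by simpa [add_right_comm] using hc.2 (n + v.length)⟩

theorem isPath_append {A : Arena σ} {v w : List σ} {s : σ} (hv : A.IsPath (v ++ [s]))
    (hw : A.IsPath w) (hs : w.head? = some s) : A.IsPath (v ++ w) := by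
  cases w with
  | nil => simp at hs
  | cons a w =>
    obtain rfl : a = s := by simpa using hs
    refine ⟨by simp, ?_, ?_⟩
    · intro t ht
      rcases List.mem_append.1 ht with ht | ht
      · exact hv.mem t (by simp [ht])
      · exact hw.mem t ht
    · have e : v ++ a :: w = v ++ [a] ++ w := by simp
      have := hw.chain
      rw [List.isChain_split]
      exact ⟨hv.chain, this⟩

theorem head?_of_mem_prefixes {c : CompletedPath σ} {u : List σ} {s : σ} (hs : [s] ∈ c.prefixes)
    (hu : u ∈ c.prefixes) : u.head? = some s := by
  have h0 := List.length_pos_iff.2 (ne_nil_of_mem_prefixes hu)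
  obtain ⟨r, rfl⟩ := prefix_of_length_le hs hu (by simpa [Nat.succ_le_iff] using h0)
  rfl

theorem exists_singleton_mem_prefixes {A : Arena σ} {c : CompletedPath σ} (hc : c.IsIn A) :
    ∃ s, [s] ∈ c.prefixes := by
  cases c with
  | fin l =>
    obtain ⟨a, l, rfl⟩ := List.exists_cons_of_ne_nil hc.1.ne_nil
    exact ⟨a, by simp, [] ++ l, by simp⟩
  | inf x => exact ⟨x 0, 0, by simp⟩

theorem IsIn.prepend {A : Arena σ} {c : CompletedPath σ} (hc : c.IsIn A) {v : List σ} {s : σ}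
    (hv : A.IsPath (v ++ [s])) (hs : [s] ∈ c.prefixes) : (c.prepend v).IsIn A := by
  cases c with
  | fin l =>
    obtain ⟨u, t, rfl, ht⟩ := hc.2
    exact ⟨isPath_append hv hc.1 (head?_of_mem_prefixes hs ⟨by simp, List.prefix_rfl⟩),
      v ++ u, t, by simp, ht⟩
  | inf x =>
    refine isIn_inf_iff.2 fun u hu => ?_
    rcases prefix_or_of_mem_prefixes_prepend (c := inf x) hu with ⟨r, rfl⟩ | ⟨w, hw, rfl⟩
    · exact ⟨ne_nil_of_mem_prefixes hu, fun s hs => hv.mem s (by simp [hs]),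
        (List.append_assoc u r [s] ▸ hv.chain).left_of_append⟩
    · exact isPath_append hv (isIn_inf_iff.1 hc w hw) (head?_of_mem_prefixes hs hw)

theorem prepend_mem_prefixes {c : CompletedPath σ} {v w : List σ} (hw : w ∈ c.prefixes) :
    v ++ w ∈ (c.prepend v).prefixes := by
  cases c with
  | fin l => exact ⟨by simp [hw.1], by simpa using hw.2⟩
  | inf x =>
    obtain ⟨n, rfl⟩ := hw
    refine ⟨v.length + n, ?_⟩
    rw [add_assoc, @List.range_add v.length (n + 1), List.map_append, List.map_map]
    congr 1
    · refine List.ext_getElem (by simp) fun i h1 h2 => ?_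
      simp [h1]
    · refine List.map_congr_left fun i _ => ?_
      simp

/-- An infinite path, or a finite one that stops in a terminal state, runs through every node with
which all its prefixes are comparable. -/
theorem mem_prefixes_of_comparable {A : Arena σ} {c : CompletedPath σ} (hc : c.IsIn A)
    {v : List σ} (hv : A.IsPath v) (h : ∀ l ∈ c.prefixes, l <+: v ∨ v <+: l) : v ∈ c.prefixes := by
  cases c with
  | fin l =>
    obtain ⟨hp, u, t, rfl, ht⟩ := hc
    have hl : u ++ [t] ∈ (fin (u ++ [t])).prefixes := ⟨by simp, List.prefix_rfl⟩
    rcases h _ hl with ⟨r, rfl⟩ | h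
    · cases r with
      | nil => simpa using hl
      | cons a r =>
        have := hv.chain
        rw [List.append_assoc, List.singleton_append, List.isChain_append_cons_cons] at this
        exact (ht _ this.2.1).elim
    · exact ⟨hv.ne_nil, h⟩
  | inf x =>
    have h0 := List.length_pos_iff.2 hv.ne_nil
    have hm : (List.range v.length).map x ∈ (inf x).prefixes :=
      ⟨v.length - 1, by rw [Nat.sub_add_cancel h0]⟩
    have : v = (List.range v.length).map x := by
      rcases h _ hm with h | h
      · exact (h.eq_of_length (by simp)).symm
      · exact h.eq_of_length (by simp)
    rw [this]
    exact hm

theorem eq_fin_or_exists_child {c : CompletedPath σ} {l : List σ} (hl : l ∈ c.prefixes) :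
    c = fin l ∨ ∃ t, l ++ [t] ∈ c.prefixes := by
  cases c with
  | fin l' =>
    obtain ⟨h0, r, rfl⟩ := hl
    cases r with
    | nil => simp
    | cons t r => exact Or.inr ⟨t, by simp, r, by simp⟩
  | inf x =>
    obtain ⟨n, rfl⟩ := hl
    exact Or.inr ⟨x (n + 1), n + 1, by rw [List.range_succ (n := n + 1), List.map_append]; rfl⟩

theorem eq_fin_of_terminal {A : Arena σ} {c : CompletedPath σ} (hc : c.IsIn A) {l : List σ} {s : σ}
    (hl : l ++ [s] ∈ c.prefixes) (hs : A.Terminal s) : c = fin (l ++ [s]) := by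
  refine (eq_fin_or_exists_child hl).resolve_right ?_
  rintro ⟨t, ht⟩
  have := (hc.isPath ht).chain
  rw [List.append_assoc, List.singleton_append, List.isChain_append_cons_cons] at this
  exact hs t this.2.1

theorem exists_child_of_not_terminal {A : Arena σ} {c : CompletedPath σ} (hc : c.IsIn A)
    {l : List σ} {s : σ} (hl : l ++ [s] ∈ c.prefixes) (hs : ¬ A.Terminal s) :
    ∃ t, l ++ [s, t] ∈ c.prefixes := by
  rcases eq_fin_or_exists_child hl with rfl | ⟨t, ht⟩
  · obtain ⟨-, u, a, e, ha⟩ := hc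
    have : s = a := by simpa using (List.append_inj' e rfl).2
    exact (hs (this ▸ ha)).elim
  · exact ⟨t, by simpa using ht⟩

/-- A strictly increasing sequence of finite sequences has an infinite limit. -/
theorem exists_inf_of_prefix_chain (f : ℕ → List σ)
    (hf : ∀ n, f n <+: f (n + 1)) (hl : ∀ n, (f n).length < (f (n + 1)).length) :
    ∃ x : ℕ → σ, (∀ n, f n ≠ [] → f n ∈ (inf x).prefixes) ∧
      ∀ u ∈ (inf x).prefixes, ∃ n, u <+: f n := by
  have hmono : ∀ {n m}, n ≤ m → f n <+: f m := fun {n m} h =>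
    Nat.le_induction List.prefix_rfl (fun k _ ih => ih.trans (hf k)) m h
  have hlen : ∀ n, n ≤ (f n).length := fun n => (strictMono_nat_of_lt_succ hl).le_apply
  let x : ℕ → σ := fun k => (f (k + 1))[k]'(hlen (k + 1))
  have key : ∀ n, f n = (List.range (f n).length).map x := by
    intro n
    refine List.ext_getElem (by simp) fun i h1 _ => ?_
    rw [List.getElem_map, List.getElem_range]
    rcases le_total n (i + 1) with h | h
    · exact (hmono h).getElem h1
    · exact ((hmono h).getElem (hlen (i + 1))).symm
  refine ⟨x, fun n hn => mem_prefixes_inf.2 ⟨hn, key n⟩, ?_⟩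
  rintro u ⟨n, rfl⟩
  refine ⟨n + 1, ?_⟩
  rw [key (n + 1), ← take_map_range x (hlen (n + 1))]
  exact List.take_prefix _ _

end CompletedPath

namespace MetaParityGame

variable {σ : Type*} (G : MetaParityGame σ)

theorem drop_mem_paritySet {c : CompletedPath σ} {v : List σ} {s : σ}
    (h : v ++ [s] ∈ c.prefixes) : c.drop v.length ∈ G.paritySet ↔ c ∈ G.paritySet := by
  cases c with
  | fin l =>
    obtain ⟨-, r, rfl⟩ := h
    obtain ⟨r', a, e⟩ : ∃ r' a, s :: r = r' ++ [a] :=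
      ((List.eq_nil_or_concat' (s :: r)).resolve_left (by simp))
    have e1 : v ++ [s] ++ r = (v ++ r') ++ [a] := by simp [e]
    rw [e1]
    have e2 : ∀ w, (CompletedPath.fin (w ++ [a]) ∈ G.paritySet) ↔ Odd (G.Ω a) := by
      intro w
      constructor
      · rintro ⟨u, t, e, h⟩
        have : a = t := by simpa using (List.append_inj' e rfl).2
        exact this ▸ h
      · exact fun h => ⟨w, a, rfl, h⟩
    rw [e2, CompletedPath.drop, List.append_assoc, List.drop_left, e2]
  | inf x =>
    have e : ∀ j, (∃ᶠ n in atTop, G.Ω (x (n + v.length)) = j) ↔ ∃ᶠ n in atTop, G.Ω (x n) = j := by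
      intro j
      conv_rhs => rw [← map_add_atTop_eq_nat v.length, frequently_map]
    simp only [CompletedPath.drop, paritySet, mem_ofPred_eq, e]

end MetaParityGame

/-! ### Subtrees of branching plays -/

namespace Arena.BP

variable {σ : Type*} {A : Arena σ}

theorem head?_eq (T : A.BP) {s : σ} (hs : [s] ∈ T.1) {l : List σ} (hl : l ∈ T.1) :
    l.head? = some s := by
  obtain ⟨a, l, rfl⟩ := List.exists_cons_of_ne_nil (T.2.path l hl).ne_nil
  have ha : [a] ∈ T.1 := T.2.down_closed _ hl [a] (by simp) ⟨l, rfl⟩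
  simp [T.2.root.unique ha hs]

theorem subtree_nil (T : A.BP) {s : σ} (h : [] ++ [s] ∈ T.1) : T.subtree [] s h = T := by
  apply Subtype.ext
  ext l
  exact ⟨fun hl => hl.2, fun hl => ⟨T.head?_eq h hl, hl⟩⟩

theorem subtree_subtree (T : A.BP) {u w : List σ} {s t : σ} (h : u ++ [s] ∈ T.1)
    (h' : w ++ [t] ∈ (T.subtree u s h).1) (h'' : (u ++ w) ++ [t] ∈ T.1) :
    (T.subtree u s h).subtree w t h' = T.subtree (u ++ w) t h'' := by
  apply Subtype.ext
  ext l
  change (l.head? = some t ∧ (w ++ l).head? = some s ∧ u ++ (w ++ l) ∈ T.1) ↔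
    (l.head? = some t ∧ (u ++ w) ++ l ∈ T.1)
  rw [List.append_assoc]
  refine and_congr_right fun hl => and_iff_right ?_
  have := h'.1
  cases w with
  | nil => simpa [hl] using this
  | cons a w => simpa using this

/-- If a node is reached through non-branching states only, then every node of the branching play is
comparable with it. -/
theorem comparable_of_forced (T : A.BP) {v : List σ} (hv : v ∈ T.1)
    (hk : ∀ s ∈ v.dropLast, A.kind s ≠ Kind.branching) {l : List σ} (hl : l ∈ T.1) :
    l <+: v ∨ v <+: l := by
  induction v using List.reverseRecOn with
  | nil => exact Or.inr l.nil_prefix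
  | append_singleton v t ih =>
    rw [List.dropLast_concat] at hk
    rcases List.eq_nil_or_concat' v with rfl | ⟨w, s, rfl⟩
    · obtain ⟨a, l, rfl⟩ := List.exists_cons_of_ne_nil (T.2.path l hl).ne_nil
      have := T.head?_eq hv hl
      rw [List.head?_cons, Option.some.injEq] at this
      subst this
      exact Or.inr ⟨l, rfl⟩
    · have hw := T.2.down_closed _ hv (w ++ [s]) (by simp) ⟨_, rfl⟩
      rcases ih hw (fun x hx => hk x (List.mem_of_mem_dropLast hx)) with h | ⟨r, rfl⟩
      · exact Or.inl (h.trans ⟨_, rfl⟩)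
      · cases r with
        | nil => exact Or.inl (by simp)
        | cons a r =>
          right
          have e : w ++ [s] ++ [t] = w ++ [s, t] := by simp
          have ha : w ++ [s, a] ∈ T.1 := T.2.down_closed _ hl _ (by simp) ⟨r, by simp⟩
          rw [e] at hv ⊢
          rcases T.2.unique w s hw (hk s (by simp)) with h | h
          · have := (T.2.path _ hv).chain
            rw [List.isChain_append_cons_cons] at this
            exact (h t this.2.1).elim
          · rw [h.unique hv ha]
            exact ⟨r, by simp⟩

end Arena.BP

/-! ### Strategy trees and their composition -/

namespace MetaParityGame

variable {σ : Type*} (G : MetaParityGame σ)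

/-- `S` is a winning strategy tree of Player 1 in `T` up to the nodes in `Stop`: a set of nodes of
`T` which contains the root and, at each of its nodes outside `Stop`, some child if Player 1 chooses
and all children otherwise, such that Player 1 wins the plays within `S` that avoid `Stop`. The set
`S` need not be closed under prefixes, and she may have several children to choose from. -/
structure PartialWin (T Stop S : Set (List σ)) : Prop where
  sub : S ⊆ T
  root : ∀ s, [s] ∈ T → [s] ∈ S
  choice : ∀ l s, l ++ [s] ∈ S → l ++ [s] ∉ Stop → G.kind s = Kind.branching →
    G.Pl s = Player.one → ¬ G.Terminal s → ∃ t, l ++ [s, t] ∈ S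
  all : ∀ l s, l ++ [s] ∈ S → l ++ [s] ∉ Stop →
    ¬ (G.kind s = Kind.branching ∧ G.Pl s = Player.one) → ∀ t, l ++ [s, t] ∈ T → l ++ [s, t] ∈ S
  win : ∀ c : CompletedPath σ, c.IsIn G.toArena → c.prefixes ⊆ S → (∀ l ∈ c.prefixes, l ∉ Stop) →
    c ∈ G.paritySet

/-- `S` is closed under non-empty prefixes and does not continue beyond the nodes in `Stop`. -/
structure Trimmed (Stop S : Set (List σ)) : Prop where
  closed : ∀ l ∈ S, ∀ t, t ≠ [] → t <+: l → t ∈ S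
  maximal : ∀ l ∈ S, ∀ t ∈ Stop, t ≠ [] → t <+: l → t = l

variable {G}

/-- A strategy tree may be pruned to the nodes all of whose proper prefixes belong to it and are not
stopping nodes. -/
theorem PartialWin.exists_trimmed {T Stop S : Set (List σ)} (h : G.PartialWin T Stop S) :
    ∃ S' ⊆ S, G.PartialWin T Stop S' ∧ Trimmed Stop S' := by
  have step : ∀ l s t, (∀ u, u ≠ [] → u <+: l ++ [s] → u ∈ S ∧ (u ∈ Stop → u = l ++ [s])) →
      l ++ [s] ∉ Stop → l ++ [s, t] ∈ S →
      ∀ u, u ≠ [] → u <+: l ++ [s, t] → u ∈ S ∧ (u ∈ Stop → u = l ++ [s, t]) := by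
    intro l s t hl hs ht u hu hul
    have e : l ++ [s, t] = (l ++ [s]) ++ [t] := by simp
    rw [e, List.prefix_concat_iff] at hul
    rcases hul with rfl | hul
    · exact ⟨e ▸ ht, fun _ => e.symm⟩
    · obtain ⟨h1, h2⟩ := hl u hu hul
      exact ⟨h1, fun h3 => (hs (h2 h3 ▸ h3)).elim⟩
  have self : ∀ l, l ≠ [] → (∀ u, u ≠ [] → u <+: l → u ∈ S ∧ (u ∈ Stop → u = l)) → l ∈ S :=
    fun l hl h => (h l hl List.prefix_rfl).1
  refine ⟨{l | l ≠ [] ∧ ∀ u, u ≠ [] → u <+: l → u ∈ S ∧ (u ∈ Stop → u = l)},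
    fun l hl => self l hl.1 hl.2, ⟨fun l hl => h.sub (self l hl.1 hl.2), ?_, ?_, ?_, ?_⟩, ?_, ?_⟩
  · intro s hs
    refine ⟨by simp, fun u hu hus => ?_⟩
    have : u = [s] := hus.eq_of_length_le (by
      have := List.length_pos_iff.2 hu
      simpa [Nat.succ_le_iff] using this)
    subst this
    exact ⟨h.root s hs, fun _ => rfl⟩
  · rintro l s ⟨-, hl⟩ hs hk hp hT
    obtain ⟨t, ht⟩ := h.choice l s (self _ (by simp) hl) hs hk hp hT
    exact ⟨t, by simp, step l s t hl hs ht⟩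
  · rintro l s ⟨-, hl⟩ hs hk t ht
    exact ⟨by simp, step l s t hl hs (h.all l s (self _ (by simp) hl) hs hk t ht)⟩
  · exact fun c hc hcS hcs => h.win c hc (fun l hl => self l (hcS hl).1 (hcS hl).2) hcs
  · rintro l ⟨-, hl⟩ t ht htl
    refine ⟨ht, fun u hu hut => ?_⟩
    obtain ⟨h1, h2⟩ := hl u hu (hut.trans htl)
    refine ⟨h1, fun h3 => hut.eq_of_length_le ?_⟩
    rw [h2 h3]
    exact htl.length_le
  · rintro l ⟨-, hl⟩ t ht ht0 htl
    exact (hl t ht0 htl).2 ht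

/-- Only the stopping nodes that belong to the strategy tree matter, and more of them may be allowed. -/
theorem PartialWin.mono {T Stop Stop' S : Set (List σ)} (h : G.PartialWin T Stop S)
    (hs : ∀ l ∈ S, l ∈ Stop → l ∈ Stop') : G.PartialWin T Stop' S :=
  ⟨h.sub, h.root, fun l s hl hl' => h.choice l s hl fun h => hl' (hs _ hl h),
    fun l s hl hl' => h.all l s hl fun h => hl' (hs _ hl h),
    fun c hc hcS hcs => h.win c hc hcS fun l hl hl' => hcs l hl (hs l (hcS hl) hl')⟩

theorem playerOneWins_iff (T : G.BP) :
    G.PlayerOneWins T.1 ↔ ∃ S, G.PartialWin T.1 ∅ S := by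
  constructor
  · rintro ⟨τ, hτ, hw⟩
    have step : ∀ l s t, l ++ [s, t] ∈ T.1 →
        (∀ u a b, u ++ [a, b] <+: l ++ [s] → G.kind a = Kind.branching → G.Pl a = Player.one →
          b = τ (u ++ [a])) →
        (G.kind s = Kind.branching → G.Pl s = Player.one → t = τ (l ++ [s])) →
        ∀ u a b, u ++ [a, b] <+: l ++ [s, t] → G.kind a = Kind.branching →
          G.Pl a = Player.one → b = τ (u ++ [a]) := by
      intro l s t _ hl hs u a b hu
      have e : l ++ [s, t] = (l ++ [s]) ++ [t] := by simp
      rw [e, List.prefix_concat_iff] at hu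
      rcases hu with hu | hu
      · have hu' : (u ++ [a]) ++ [b] = (l ++ [s]) ++ [t] := by simpa using hu
        obtain ⟨h1, h2⟩ := List.append_inj' hu' rfl
        obtain ⟨rfl, h3⟩ := List.append_inj' h1 rfl
        obtain rfl : b = t := by simpa using h2
        obtain rfl : a = s := by simpa using h3
        exact hs
      · exact hl u a b hu
    refine ⟨{l | l ∈ T.1 ∧ ∀ u a b, u ++ [a, b] <+: l → G.kind a = Kind.branching →
      G.Pl a = Player.one → b = τ (u ++ [a])}, fun l hl => hl.1, ?_, ?_, ?_, ?_⟩
    · refine fun s hs => ⟨hs, fun u a b h => ?_⟩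
      have := h.length_le
      simp at this
    · rintro l s ⟨hl, hl'⟩ - hk hp ht
      have := hτ l s hl hk hp ht
      exact ⟨_, this, step l s _ this hl' fun _ _ => rfl⟩
    · rintro l s ⟨hl, hl'⟩ - hk t ht
      exact ⟨ht, step l s t ht hl' fun h1 h2 => (hk ⟨h1, h2⟩).elim⟩
    · intro c hc hcS _
      exact hw c hc (fun l hl => (hcS hl).1) fun l s t hl =>
        (hcS hl).2 l s t List.prefix_rfl
  · rintro ⟨S, hS⟩
    classical
    obtain ⟨s₀, hs₀, -⟩ := T.2.root
    -- Outside `S` the values are irrelevant, but a strategy has to select children in `T` there too.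
    let τ : List σ → σ := fun l => if h : ∃ t, l ++ [t] ∈ S then h.choose else
      if h' : ∃ t, l ++ [t] ∈ T.1 then h'.choose else s₀
    refine ⟨τ, ?_, ?_⟩
    · intro l s hl hk _ ht
      have e : ∀ t, l ++ [s, t] = (l ++ [s]) ++ [t] := by simp
      obtain ⟨t, ht⟩ : ∃ t, G.E s t := by simpa [Arena.Terminal] using ht
      have hT : ∃ t, (l ++ [s]) ++ [t] ∈ T.1 := ⟨t, e t ▸ T.2.full l s hl hk t ht⟩
      rw [e]
      by_cases h : ∃ t, (l ++ [s]) ++ [t] ∈ S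
      · simp only [τ, dif_pos h]
        exact hS.sub h.choose_spec
      · simp only [τ, dif_neg h, dif_pos hT]
        exact hT.choose_spec
    · intro c hc hcT hcons
      refine hS.win c hc (fun l hl => ?_) fun l _ h => h
      induction l using List.reverseRecOn with
      | nil => exact absurd rfl (CompletedPath.ne_nil_of_mem_prefixes hl)
      | append_singleton l t ih =>
        rcases List.eq_nil_or_concat' l with rfl | ⟨l, s, rfl⟩
        · exact hS.root t (hcT hl)
        · have e : ∀ t, (l ++ [s]) ++ [t] = l ++ [s, t] := by simp
          have h := ih (CompletedPath.mem_prefixes_of_prefix hl (by simp) ⟨_, rfl⟩)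
          by_cases hk : G.kind s = Kind.branching ∧ G.Pl s = Player.one
          · have hE := (hc.isPath hl).chain
            rw [e, List.isChain_append_cons_cons] at hE
            have hex : ∃ t, (l ++ [s]) ++ [t] ∈ S := by
              obtain ⟨t', ht'⟩ := hS.choice l s h (fun h => h) hk.1 hk.2 fun h => h _ hE.2.1
              exact ⟨t', e t' ▸ ht'⟩
            have : t = τ (l ++ [s]) := hcons l s t (e t ▸ hl) hk.1 hk.2
            rw [this]
            simp only [τ, dif_pos hex]
            exact hex.choose_spec
          · rw [e]
            exact hS.all l s h (fun h => h) hk t (e t ▸ hcT hl)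

theorem mem_Φ_iff (T : G.BP) : T ∈ G.Φ ↔ ∃ S, G.PartialWin T.1 ∅ S := playerOneWins_iff T

theorem PartialWin.subtree {T : G.BP} {Stop S : Set (List σ)} (hS : G.PartialWin T.1 Stop S)
    (ht : Trimmed Stop S) {u : List σ} {s : σ} (h : u ++ [s] ∈ T.1) (hu : u ++ [s] ∈ S) :
    G.PartialWin (Arena.BP.subtree T u s h).1 {w | u ++ w ∈ Stop}
      {w | w.head? = some s ∧ u ++ w ∈ S} := by
  have hd : ∀ (l : List σ) (a b : σ), (l ++ [a]).head? = some s → (l ++ [a, b]).head? = some s := by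
    intro l a b h
    cases l <;> simpa using h
  refine ⟨fun w hw => ⟨hw.1, hS.sub hw.2⟩, ?_, ?_, ?_, ?_⟩
  · rintro a ⟨ha, -⟩
    obtain rfl : a = s := by simpa using ha
    exact ⟨rfl, hu⟩
  · rintro l a ⟨hl, hl'⟩ hs hk hp hT
    obtain ⟨b, hb⟩ := hS.choice (u ++ l) a (by simpa using hl') (by simpa using hs) hk hp hT
    exact ⟨b, hd l a b hl, by simpa using hb⟩
  · rintro l a ⟨hl, hl'⟩ hs hk b ⟨-, hb⟩
    exact ⟨hd l a b hl, by
      simpa using hS.all (u ++ l) a (by simpa using hl') (by simpa using hs) hk b (by simpa using hb)⟩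
  · intro c hc hcS hcs
    obtain ⟨a, ha⟩ := CompletedPath.exists_singleton_mem_prefixes hc
    obtain rfl : a = s := by simpa using (hcS ha).1
    have hp := CompletedPath.prepend_mem_prefixes (v := u) ha
    rw [← CompletedPath.drop_prepend u c, G.drop_mem_paritySet hp]
    refine hS.win _ (hc.prepend (T.2.path _ h) ha) (fun l hl => ?_) fun l hl hl' => ?_
    · rcases CompletedPath.prefix_or_of_mem_prefixes_prepend hl with h | ⟨w, hw, rfl⟩
      · exact ht.closed _ hu l (CompletedPath.ne_nil_of_mem_prefixes hl) (h.trans ⟨_, rfl⟩)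
      · exact (hcS hw).2
    · rcases CompletedPath.prefix_or_of_mem_prefixes_prepend hl with h | ⟨w, hw, rfl⟩
      · have := ht.maximal _ hu l hl' (CompletedPath.ne_nil_of_mem_prefixes hl) (h.trans ⟨_, rfl⟩)
        have h2 := h.length_le
        rw [this] at h2
        simp at h2
      · exact hcs w hw hl'

/-- A strategy tree contains each node that is reached through non-branching states only. -/
theorem PartialWin.mem_of_forced {T : G.BP} {Stop S : Set (List σ)} (hS : G.PartialWin T.1 Stop S)
    {v : List σ} (hv : v ∈ T.1) (hk : ∀ s ∈ v.dropLast, G.kind s ≠ Kind.branching)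
    (hs : ∀ t, t <+: v.dropLast → t ∉ Stop) : v ∈ S := by
  induction v using List.reverseRecOn with
  | nil => exact absurd rfl (T.2.path _ hv).ne_nil
  | append_singleton v t ih =>
    rw [List.dropLast_concat] at hk hs
    rcases List.eq_nil_or_concat' v with rfl | ⟨w, s, rfl⟩
    · exact hS.root t hv
    · have hw := ih (T.2.down_closed _ hv (w ++ [s]) (by simp) ⟨_, rfl⟩)
        (fun x hx => hk x (List.mem_of_mem_dropLast hx))
        fun t ht => hs t (ht.trans (List.dropLast_prefix _))
      rw [List.append_assoc] at hv ⊢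
      exact hS.all w s hw (hs _ List.prefix_rfl) (fun h => hk s (by simp) h.1) t hv

theorem PartialWin.subtree_mem_Φ {T : G.BP}
    {S : Set (List σ)} (hS : G.PartialWin T.1 ∅ S) (ht : Trimmed ∅ S) {u : List σ} {s : σ}
    (h : u ++ [s] ∈ T.1) (hu : u ++ [s] ∈ S) : Arena.BP.subtree T u s h ∈ G.Φ :=
  (mem_Φ_iff _).2 ⟨_, (hS.subtree ht h hu).mono fun _ _ h => h⟩

/-- Composition of strategies: the tree is cut at the nodes in `Cut`. If Player 1 has, from every cut
node, a winning strategy tree up to the next cut nodes, and wins every play with infinitely many cut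
nodes, then she wins by following the strategy tree of the last cut node passed. -/
theorem playerOneWins_of_cut (T : G.BP) (Cut : Set (List σ))
    (hroot : ∀ s, [s] ∈ T.1 → [s] ∈ Cut)
    (hseg : ∀ u s (h : u ++ [s] ∈ T.1), u ++ [s] ∈ Cut →
      ∃ S, G.PartialWin (Arena.BP.subtree T u s h).1 {w | 2 ≤ w.length ∧ u ++ w ∈ Cut} S)
    (hinf : ∀ c : CompletedPath σ, c.IsIn G.toArena → c.prefixes ⊆ T.1 →
      (∀ n, ∃ u ∈ c.prefixes, u ∈ Cut ∧ n < u.length) → c ∈ G.paritySet) :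
    T ∈ G.Φ := by
  have key : ∀ u s (h : u ++ [s] ∈ T.1), u ++ [s] ∈ Cut →
      ∃ S, G.PartialWin (Arena.BP.subtree T u s h).1 {w | 2 ≤ w.length ∧ u ++ w ∈ Cut} S ∧
        Trimmed {w | 2 ≤ w.length ∧ u ++ w ∈ Cut} S := by
    intro u s h hu
    obtain ⟨S, hS⟩ := hseg u s h hu
    obtain ⟨S', -, hS'⟩ := hS.exists_trimmed
    exact ⟨S', hS'⟩
  choose! S hS ht using key
  rw [mem_Φ_iff]
  have hmem : ∀ u s (h : u ++ [s] ∈ T.1), u ++ [s] ∈ Cut → [s] ∈ S u s := fun u s h hu =>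
    (hS u s h hu).root s ⟨rfl, h⟩
  -- A node of the composed tree which is cut is also the root of its own segment.
  have norm : ∀ u s (h : u ++ [s] ∈ T.1), u ++ [s] ∈ Cut → ∀ w ∈ S u s, ∃ u' s',
      ∃ h' : u' ++ [s'] ∈ T.1, u' ++ [s'] ∈ Cut ∧ ∃ w' ∈ S u' s', u ++ w = u' ++ w' ∧
        ¬ (2 ≤ w'.length ∧ u' ++ w' ∈ Cut) := by
    intro u s h hu w hw
    by_cases hc : 2 ≤ w.length ∧ u ++ w ∈ Cut
    · have hwT := ((hS u s h hu).sub hw).2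
      rcases List.eq_nil_or_concat' w with rfl | ⟨w, a, rfl⟩
      · simp at hc
      · rw [← List.append_assoc] at hwT hc
        exact ⟨u ++ w, a, hwT, hc.2, [a], hmem _ _ hwT hc.2, by simp, by simp⟩
    · exact ⟨u, s, h, hu, w, hw, rfl, hc⟩
  have last : ∀ (u w l : List σ) (a s : σ), l ++ [a] = u ++ w → w.head? = some s →
      ∃ w', w = w' ++ [a] ∧ l = u ++ w' := by
    intro u w l a s e hw
    rcases List.eq_nil_or_concat' w with rfl | ⟨w, b, rfl⟩
    · simp at hw
    · rw [← List.append_assoc] at e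
      obtain ⟨h1, h2⟩ := List.append_inj' e rfl
      exact ⟨w, by rw [h2], h1⟩
  have hd : ∀ (l : List σ) (a b s : σ), (l ++ [a]).head? = some s →
      (l ++ [a, b]).head? = some s := by
    intro l a b s h
    cases l <;> simpa using h
  refine ⟨{l | ∃ u s, ∃ h : u ++ [s] ∈ T.1, u ++ [s] ∈ Cut ∧ ∃ w ∈ S u s, l = u ++ w},
    ?_, ?_, ?_, ?_, ?_⟩
  · rintro l ⟨u, s, h, hu, w, hw, rfl⟩
    exact ((hS u s h hu).sub hw).2
  · intro s hs
    exact ⟨[], s, hs, hroot s hs, [s], hmem [] s hs (hroot s hs), rfl⟩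
  · rintro l a ⟨u, s, h, hu, w, hw, e⟩ - hk hp hT
    obtain ⟨u, s, h, hu, w', hw', e', hc⟩ := norm u s h hu w hw
    rw [e'] at e
    obtain ⟨w', rfl, rfl⟩ := last u w' l a s e ((hS u s h hu).sub hw').1
    obtain ⟨b, hb⟩ := (hS u s h hu).choice w' a hw' hc hk hp hT
    exact ⟨b, u, s, h, hu, _, hb, by simp⟩
  · rintro l a ⟨u, s, h, hu, w, hw, e⟩ - hk b hb
    obtain ⟨u, s, h, hu, w', hw', e', hc⟩ := norm u s h hu w hw
    rw [e'] at e
    have hh := ((hS u s h hu).sub hw').1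
    obtain ⟨w', rfl, rfl⟩ := last u w' l a s e hh
    exact ⟨u, s, h, hu, _, (hS u s h hu).all w' a hw' hc hk b ⟨hd w' a b s hh, by simpa using hb⟩,
      by simp⟩
  · intro c hc hcS _
    have hcT : c.prefixes ⊆ T.1 := by
      intro l hl
      obtain ⟨u, s, h, hu, w, hw, rfl⟩ := hcS hl
      exact ((hS u s h hu).sub hw).2
    by_cases hb : ∀ n, ∃ u ∈ c.prefixes, u ∈ Cut ∧ n < u.length
    · exact hinf c hc hcT hb
    · push Not at hb
      obtain ⟨N, hN⟩ := hb
      obtain ⟨s₀, hs₀⟩ := CompletedPath.exists_singleton_mem_prefixes hc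
      have hne : {n | ∃ u ∈ c.prefixes, u ∈ Cut ∧ u.length = n}.Nonempty :=
        ⟨_, [s₀], hs₀, hroot _ (hcT hs₀), rfl⟩
      have hbd : BddAbove {n | ∃ u ∈ c.prefixes, u ∈ Cut ∧ u.length = n} := by
        refine ⟨N, ?_⟩
        rintro n ⟨u, hu, hu', rfl⟩
        exact hN u hu hu'
      obtain ⟨v, hv, hvC, hvl⟩ := Nat.sSup_mem hne hbd
      have hmax : ∀ u ∈ c.prefixes, u ∈ Cut → u.length ≤ v.length := by
        intro u hu hu'
        rw [hvl]
        exact le_csSup hbd ⟨u, hu, hu', rfl⟩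
      obtain ⟨v, s, rfl⟩ :=
        (List.eq_nil_or_concat' v).resolve_left (CompletedPath.ne_nil_of_mem_prefixes hv)
      rw [← G.drop_mem_paritySet hv]
      have hvT := hcT hv
      refine (hS v s hvT hvC).win _ (hc.drop hv) (fun w hw => ?_) fun w hw hw' => ?_
      · obtain ⟨hw0, hw⟩ := (CompletedPath.mem_prefixes_drop hv).1 hw
        obtain ⟨u, a, h, hu, z, hz, e⟩ := hcS hw
        have hz0 : z ≠ [] := by
          rintro rfl
          have := ((hS u a h hu).sub hz).1
          simp at this
        have hza : z.head? = some a := ((hS u a h hu).sub hz).1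
        have hul : u ++ [a] <+: v ++ w := by
          obtain ⟨b, z, rfl⟩ := List.exists_cons_of_ne_nil hz0
          obtain rfl : b = a := by simpa using hza
          exact ⟨z, by simp [e]⟩
        have hvl : v ++ [s] <+: v ++ w :=
          CompletedPath.prefix_of_length_le hv hw (by
            have := List.length_pos_iff.2 hw0
            simpa [Nat.succ_le_iff] using this)
        have huv : u ++ [a] <+: v ++ [s] := List.prefix_of_prefix_length_le hul hvl
          (hmax _ (CompletedPath.mem_prefixes_of_prefix hw (by simp) hul) hu)
        obtain ⟨r, hr⟩ := huv
        rw [List.append_assoc] at hr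
        rcases List.eq_nil_or_concat' r with rfl | ⟨r, b, rfl⟩
        · obtain ⟨rfl, h2⟩ := List.append_inj' hr rfl
          obtain rfl : a = s := by simpa using h2
          rwa [List.append_cancel_left e]
        · -- The last cut node lies strictly inside the segment containing `v ++ w`, so that segment
          -- ends there.
          have hst := (ht u a h hu).maximal z hz ([a] ++ (r ++ [b]))
            ⟨by simp, by rw [hr]; exact hvC⟩ (by simp) (by
              rw [← List.prefix_append_right_inj u, hr, ← e]
              exact hvl)
          have h3 : v ++ w = v ++ [s] := by rw [e, ← hst, hr]
          rw [List.append_cancel_left h3]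
          exact hmem v s hvT hvC
      · obtain ⟨hw0, hw⟩ := (CompletedPath.mem_prefixes_drop hv).1 hw
        have h1 := hmax _ hw hw'.2
        have h2 := hw'.1
        simp only [List.length_append, List.length_cons, List.length_nil] at h1
        omega

end MetaParityGame

end TreeGame

namespace PLMu

open TreeGame

section Game

variable {V L P : Type*} {𝓛 : PLTS L P} {ρ : V → P → unitInterval}

open Formula State

/-! ### The games for `⋆X.F` and for `F` -/

/-- The finite sequences of states whose last state has the form `⟨p, X⟩` and is preceded by at least
`k` states. -/
def holeNodes (X : V) (k : ℕ) : Set (List (State V L P)) :=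
  {l | ∃ u s, l = u ++ [s] ∧ k ≤ u.length ∧ IsHole X s}

theorem append_singleton_mem_holeNodes {X : V} {k : ℕ} {u : List (State V L P)}
    {s : State V L P} : u ++ [s] ∈ holeNodes X k ↔ k ≤ u.length ∧ IsHole X s := by
  constructor
  · rintro ⟨u', s', e, h⟩
    obtain ⟨rfl, h2⟩ := List.append_inj' e rfl
    obtain rfl : s = s' := by simpa using h2
    exact h
  · exact fun h => ⟨u, s, rfl, h⟩

theorem kind_ne_branching_of_isHole {X : V} {s : State V L P} (hs : IsHole X s) (G : Formula V L) :
    kind G s ≠ Kind.branching := by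
  obtain ⟨p, rfl⟩ := hs
  simp only [kind]
  split_ifs <;> simp

/-- In a normal formula, the binder of `X` at the root is the only one. -/
theorem eq_of_fix_mem {b c : Binder} {X : V} {F H : Formula V L} (hn : (fix b X F).IsNormal)
    (h : fix c X H ∈ (fix b X F).Sub) : H = F := by
  rcases h with h | h
  · exact (Formula.fix.inj (mem_singleton_iff.1 h)).2.2
  · exact ((List.nodup_cons.1 hn.1).1 (mem_binders h)).elim

theorem mem_succ_hole_iff {b : Binder} {X : V} {F : Formula V L} (hn : (fix b X F).IsNormal) {p : P}
    {t : State V L P} : t ∈ succ 𝓛 (fix b X F) (node p (var X)) ↔ t = node p F := by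
  constructor
  · rintro (⟨h, -⟩ | ⟨c, H, hH, rfl⟩)
    · simp [Formula.free] at h
    · rw [eq_of_fix_mem hn hH]
  · rintro rfl
    exact Or.inr ⟨b, F, mem_Sub_self _, rfl⟩

theorem mem_states_fix {b : Binder} {X : V} {F : Formula V L} {s : State V L P}
    (hs : s ∈ states 𝓛 F) : s ∈ states 𝓛 (fix b X F) := by
  cases s with
  | node p G => exact Or.inr hs
  | distr d G => exact ⟨hs.1, Or.inr hs.2⟩
  | top => trivial
  | bot => trivial

theorem priority_hole {b : Binder} {X : V} {F : Formula V L} (hn : (fix b X F).IsNormal) (r : V → ℕ)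
    (p : P) : priority 𝓛 (fix b X F) r (node p (var X)) = r X := by
  have h : succ 𝓛 (fix b X F) (node p (var X) : State V L P) ≠ ∅ := fun h => by
    have := (mem_succ_hole_iff (𝓛 := 𝓛) hn (p := p)).2 rfl
    rw [h] at this
    exact this
  simp only [priority, h, and_false, if_false]
  exact if_pos ⟨b, F, mem_Sub_self _⟩

/-- `X` has the greatest priority in the game for `⋆X.F`, except possibly for terminal states. -/
theorem priority_le {b : Binder} {X : V} {F : Formula V L} {r : V → ℕ}
    (hr : (fix b X F).IsPriority r) {s : State V L P} (hs : succ 𝓛 (fix b X F) s ≠ ∅) :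
    priority 𝓛 (fix b X F) r s ≤ r X := by
  simp only [priority, hs, and_false, if_false]
  split
  · split_ifs with h
    · obtain ⟨c, H, hH⟩ := h
      rcases hH with hH | hH
      · obtain ⟨-, rfl, -⟩ := Formula.fix.inj (mem_singleton_iff.1 hH)
        exact le_rfl
      · exact (hr.lt X _ ⟨b, F, c, H, mem_Sub_self _, Or.inr hH, hH⟩).le
    · exact Nat.zero_le _
  · exact Nat.zero_le _

theorem priority_congr {b : Binder} {X : V} {F : Formula V L} {r : V → ℕ} {s : State V L P}
    (hs : s ∈ states 𝓛 F) (hX : ¬ IsHole X s) :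
    priority 𝓛 (fix b X F) r s = priority 𝓛 F r s := by
  have h := mem_states_fix (b := b) (X := X) hs
  simp only [priority, hs, h, (succ_eq (𝓛 := 𝓛) (b := b) (F := F) hX).1,
    (succ_eq (𝓛 := 𝓛) (b := b) (F := F) hX).2]
  split_ifs
  · rfl
  · rcases s with ⟨p, Y | _ | _ | _⟩ | _ | _ | _ <;> try rfl
    have hY : Y ≠ X := by
      rintro rfl
      exact hX ⟨p, rfl⟩
    have e : (∃ c H, fix c Y H ∈ (fix b X F).Sub) ↔ ∃ c H, fix c Y H ∈ F.Sub := by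
      simp [Formula.Sub, hY]
    classical exact if_congr e rfl rfl

/-- Below a path without states `⟨p, X⟩`, filling does not change the children. -/
theorem mem_fill_child {X : V} {T : Set (List (State V L P))}
    {c : (l : List (State V L P)) → (s : State V L P) → l ++ [s] ∈ T → State V L P}
    {l : List (State V L P)} {s t : State V L P} (hl : ∀ a ∈ l, ¬ IsHole X a) (hs : ¬ IsHole X s) :
    l ++ [s, t] ∈ fill X T c ↔ l ++ [s, t] ∈ T := by
  constructor
  · rintro (h | ⟨l', s', h, hs', -, e⟩)
    · exact h.1
    · have e' : l = l' ∧ s = s' ∧ t = c l' s' h := by simpa using List.append_inj' e rfl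
      exact (hs (e'.2.1 ▸ hs')).elim
  · intro h
    refine Or.inl ⟨h, ?_⟩
    have e : (l ++ [s, t]).dropLast = l ++ [s] := by simp
    rw [e]
    simp only [List.mem_append, List.mem_singleton]
    rintro x (hx | rfl)
    · exact hl x hx
    · exact hs

variable [Countable L] [Countable P] {b : Binder} {X : V} {F : Formula V L} {r : V → ℕ}

theorem terminal_congr {s : State V L P} (hs : s ∈ states 𝓛 F) (hX : ¬ IsHole X s) :
    (game 𝓛 ρ (fix b X F) r).Terminal s ↔ (game 𝓛 ρ F r).Terminal s :=
  forall_congr' fun _ => not_congr (edge_congr hs hX)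

/-- The games for `⋆X.F` and `F` have the same completed paths among those which stay in the game for
`F` and avoid the states `⟨p, X⟩`. -/
theorem isIn_congr {c : CompletedPath (State V L P)}
    (h : ∀ l s, l ++ [s] ∈ c.prefixes → s ∈ states 𝓛 F ∧ ¬ IsHole X s) :
    c.IsIn (game 𝓛 ρ (fix b X F) r).toArena ↔ c.IsIn (game 𝓛 ρ F r).toArena := by
  cases c with
  | fin l =>
    have hl : ∀ s ∈ l, s ∈ states 𝓛 F ∧ ¬ IsHole X s := by
      intro s hs
      obtain ⟨u, v, rfl⟩ := List.append_of_mem hs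
      exact h u s ⟨by simp, v, by simp⟩
    have hp : (game 𝓛 ρ (fix b X F) r).IsPath l ↔ (game 𝓛 ρ F r).IsPath l := by
      have hch : l.IsChain (game 𝓛 ρ (fix b X F) r).E ↔ l.IsChain (game 𝓛 ρ F r).E := by
        simp only [List.isChain_iff_forall_rel_of_append_cons_cons]
        refine forall_congr' fun s => forall_congr' fun t => forall_congr' fun u =>
          forall_congr' fun v => forall_congr' fun e => ?_
        have hs := hl s (by simp [e])
        exact edge_congr hs.1 hs.2
      exact ⟨fun ⟨h1, _, h3⟩ => ⟨h1, fun s hs => (hl s hs).1, hch.1 h3⟩,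
        fun ⟨h1, _, h3⟩ => ⟨h1, fun s hs => mem_states_fix (hl s hs).1, hch.2 h3⟩⟩
    refine and_congr hp (exists_congr fun u => exists_congr fun s => and_congr_right fun e => ?_)
    have hs := hl s (by simp [e])
    exact terminal_congr hs.1 hs.2
  | inf x =>
    have hx : ∀ n, x n ∈ states 𝓛 F ∧ ¬ IsHole X (x n) := fun n =>
      h ((List.range n).map x) (x n) ⟨n, by rw [List.range_succ, List.map_append]; rfl⟩
    exact ⟨fun h => ⟨fun n => (hx n).1, fun n => (edge_congr (hx n).1 (hx n).2).1 (h.2 n)⟩,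
      fun h => ⟨fun n => mem_states_fix (hx n).1,
        fun n => (edge_congr (hx n).1 (hx n).2).2 (h.2 n)⟩⟩

theorem paritySet_congr {c : CompletedPath (State V L P)}
    (h : ∀ l s, l ++ [s] ∈ c.prefixes → s ∈ states 𝓛 F ∧ ¬ IsHole X s) :
    c ∈ (game 𝓛 ρ (fix b X F) r).paritySet ↔ c ∈ (game 𝓛 ρ F r).paritySet := by
  cases c with
  | fin l =>
    refine exists_congr fun u => exists_congr fun s => and_congr_right fun e => ?_
    have hs := h u s ⟨by simp, by rw [e]⟩
    exact iff_of_eq (congrArg Odd (priority_congr hs.1 hs.2))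
  | inf x =>
    have hx : ∀ n, (game 𝓛 ρ (fix b X F) r).Ω (x n) = (game 𝓛 ρ F r).Ω (x n) := fun n =>
      have hs := h ((List.range n).map x) (x n) ⟨n, by rw [List.range_succ, List.map_append]; rfl⟩
      priority_congr hs.1 hs.2
    simp only [MetaParityGame.paritySet, mem_ofPred_eq, hx]

/-- A play passing through infinitely many states `⟨p, X⟩` is decided by the parity of `r X`. -/
theorem mem_paritySet_of_holes (hn : (fix b X F).IsNormal) (hr : (fix b X F).IsPriority r)
    {c : CompletedPath (State V L P)} (hc : c.IsIn (game 𝓛 ρ (fix b X F) r).toArena)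
    (h : ∀ n, ∃ u ∈ c.prefixes, u ∈ holeNodes X 0 ∧ n < u.length) :
    c ∈ (game 𝓛 ρ (fix b X F) r).paritySet ↔ Even (r X) := by
  cases c with
  | fin l =>
    obtain ⟨u, hu, -, hl⟩ := h l.length
    exact absurd hu.2.length_le (by omega)
  | inf x =>
    have key : IsGreatest {j | ∃ᶠ n in atTop, (game 𝓛 ρ (fix b X F) r).Ω (x n) = j} (r X) := by
      constructor
      · refine frequently_atTop.2 fun a => ?_
        obtain ⟨u, ⟨n, rfl⟩, hu, hl⟩ := h a
        rw [List.range_succ, List.map_append, List.map_singleton,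
          append_singleton_mem_holeNodes] at hu
        obtain ⟨-, p, hp⟩ := hu
        refine ⟨n, by simpa [Nat.lt_succ_iff] using hl, ?_⟩
        rw [hp]
        exact priority_hole hn r p
      · intro j hj
        obtain ⟨n, rfl⟩ := hj.exists
        refine priority_le hr fun h => ?_
        have := (hc.2 n).2
        rw [h] at this
        exact this
    constructor
    · rintro ⟨k, hk, hk'⟩
      exact hk.unique key ▸ hk'
    · exact fun h => ⟨r X, key, h⟩

/-! ### The operator `𝕎` in terms of strategy trees -/

/-- Player 1 wins the filled tree iff she has a strategy tree in the original one which wins up to the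
first states `⟨p, X⟩` and reaches them only at subtrees in `Y`. -/
theorem playerOneWins_fill_iff (hn : (fix b X F).IsNormal) (Y : Set (game 𝓛 ρ (fix b X F) r).BP)
    (T : (game 𝓛 ρ (fix b X F) r).BP) (hT : ∀ l ∈ T.1, ∀ s ∈ l, s ∈ states 𝓛 F)
    (hB : (game 𝓛 ρ F r).IsBranchingPlay
      (fill X T.1 fun l s h => leaf 𝓛 ρ Y (Arena.BP.subtree T l s h))) :
    (game 𝓛 ρ F r).PlayerOneWins
        (fill X T.1 fun l s h => leaf 𝓛 ρ Y (Arena.BP.subtree T l s h)) ↔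
      ∃ S, (game 𝓛 ρ (fix b X F) r).PartialWin T.1 (holeNodes X 0) S ∧
        ∀ l s (h : l ++ [s] ∈ T.1), l ++ [s] ∈ S → IsHole X s → Arena.BP.subtree T l s h ∈ Y := by
  classical
  refine (MetaParityGame.playerOneWins_iff (G := game 𝓛 ρ F r) ⟨_, hB⟩).trans ?_
  have hkind : ∀ {s : State V L P}, ¬ IsHole X s →
      (game 𝓛 ρ (fix b X F) r).kind s = (game 𝓛 ρ F r).kind s := fun {s} hs =>
    (succ_eq (𝓛 := 𝓛) hs).2
  constructor
  · rintro ⟨S₀, hS₀⟩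
    obtain ⟨S, -, hS, ht⟩ := hS₀.exists_trimmed
    have hmem : ∀ l (s : State V L P), l ++ [s] ∉ holeNodes X 0 → ¬ IsHole X s := fun l s h hs =>
      h (append_singleton_mem_holeNodes.2 ⟨Nat.zero_le _, hs⟩)
    have hnext : ∀ l (s t : State V L P), (∀ a ∈ (l ++ [s]).dropLast, ¬ IsHole X a) →
        ¬ IsHole X s → ∀ a ∈ (l ++ [s, t]).dropLast, ¬ IsHole X a := by
      intro l s t hl hs a ha
      have e : (l ++ [s, t]).dropLast = l ++ [s] := by simp
      rw [e, List.mem_append, List.mem_singleton] at ha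
      rw [List.dropLast_concat] at hl
      rcases ha with ha | rfl
      · exact hl a ha
      · exact hs
    refine ⟨{l | l ∈ S ∧ l ∈ T.1 ∧ ∀ a ∈ l.dropLast, ¬ IsHole X a},
      ⟨fun l hl => hl.2.1, ?_, ?_, ?_, ?_⟩, ?_⟩
    · exact fun s hs => ⟨hS.root s (Or.inl ⟨hs, by simp⟩), hs, by simp⟩
    · rintro l s ⟨hl, hlT, hh⟩ hs hk hp hterm
      replace hs := hmem l s hs
      have hsF := hT _ hlT s (by simp)
      obtain ⟨t, ht⟩ := hS.choice l s hl (fun h => h) ((hkind hs).symm.trans hk) hp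
        fun h => hterm ((terminal_congr hsF hs).2 h)
      exact ⟨t, ht, (mem_fill_child (by simpa using hh) hs).1 (hS.sub ht), hnext l s t hh hs⟩
    · rintro l s ⟨hl, hlT, hh⟩ hs hk t ht
      replace hs := hmem l s hs
      refine ⟨hS.all l s hl (fun h => h) ?_ t ((mem_fill_child (by simpa using hh) hs).2 ht), ht,
        hnext l s t hh hs⟩
      exact fun h => hk ⟨(hkind hs).trans h.1, h.2⟩
    · intro c hc hcS hcs
      have hcF : ∀ l s, l ++ [s] ∈ c.prefixes → s ∈ states 𝓛 F ∧ ¬ IsHole X s := fun l s hl =>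
        ⟨hT _ (hcS hl).2.1 s (by simp), hmem l s (hcs _ hl)⟩
      exact (paritySet_congr hcF).2 (hS.win c ((isIn_congr hcF).1 hc) (fun l hl => (hcS hl).1)
        fun l _ h => h)
    · rintro l s h ⟨hl, -, hh⟩ hs
      by_contra hY
      -- Otherwise the leaf below this node is `⊥`, and its branch is lost.
      have hbot : l ++ [s, bot] ∈ fill X T.1
          fun l s h => leaf 𝓛 ρ Y (Arena.BP.subtree T l s h) :=
        Or.inr ⟨l, s, h, hs, by simpa using hh, by simp [leaf, hY]⟩
      have hbS := hS.all l s hl (fun h => h) (fun h => kind_ne_branching_of_isHole hs F h.1) bot hbot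
      have hc : CompletedPath.IsIn (game 𝓛 ρ F r).toArena
          (CompletedPath.fin (l ++ [s, bot])) :=
        ⟨hB.path _ hbot, l ++ [s], bot, by simp, fun t h => h.2⟩
      obtain ⟨u, a, e, ha⟩ := hS.win _ hc (fun u hu => ht.closed _ hbS u hu.1 hu.2) fun l _ h => h
      have e' : (l ++ [s]) ++ [bot] = u ++ [a] := by simpa using e
      obtain rfl : bot = a := by simpa using (List.append_inj' e' rfl).2
      have hbot : (game 𝓛 ρ F r).Ω bot = 0 := by
        simp [game, priority, kind]
      rw [hbot] at ha
      simp at ha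
  · rintro ⟨S₀, hS₀, hY₀⟩
    obtain ⟨S, hSS, hS, ht⟩ := hS₀.exists_trimmed
    have hY : ∀ l s (h : l ++ [s] ∈ T.1), l ++ [s] ∈ S → IsHole X s →
        Arena.BP.subtree T l s h ∈ Y := fun l s h hl => hY₀ l s h (hSS hl)
    have hfree : ∀ l ∈ S, ∀ a ∈ l.dropLast, ¬ IsHole X a := by
      intro l hl a ha hX
      obtain ⟨u, v, e⟩ := List.append_of_mem ha
      obtain ⟨w, c, rfl⟩ := (List.eq_nil_or_concat' l).resolve_left (by rintro rfl; simp at ha)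
      rw [List.dropLast_concat] at e
      have := ht.maximal _ hl (u ++ [a])
        (append_singleton_mem_holeNodes.2 ⟨Nat.zero_le _, hX⟩) (by simp) ⟨v ++ [c], by simp [e]⟩
      have := congrArg List.length this
      simp [e] at this
    refine ⟨S ∪ {l | ∃ u s, u ++ [s] ∈ S ∧ IsHole X s ∧ l = u ++ [s, top]}, ?_, ?_, ?_, ?_, ?_⟩
    · rintro l (hl | ⟨u, s, hu, hs, rfl⟩)
      · exact Or.inl ⟨hS.sub hl, hfree l hl⟩
      · have := hY u s (hS.sub hu) hu hs
        exact Or.inr ⟨u, s, hS.sub hu, hs, by simpa using hfree _ hu, by simp [leaf, this]⟩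
    · rintro s (hs | ⟨l, s', h, -, -, e⟩)
      · exact Or.inl (hS.root s hs.1)
      · have := congrArg List.length e
        simp at this
    · rintro l s (hl | ⟨u, a, hu, ha, e⟩) - hk hp hterm
      · have hs : ¬ IsHole X s := fun h => kind_ne_branching_of_isHole h F hk
        have hsF := hT _ (hS.sub hl) s (by simp)
        obtain ⟨t, ht⟩ := hS.choice l s hl
          (fun h => hs (append_singleton_mem_holeNodes.1 h).2) ((hkind hs).trans hk) hp
          fun h => hterm ((terminal_congr hsF hs).1 h)
        exact ⟨t, Or.inl ht⟩
      · have e' : l ++ [s] = (u ++ [a]) ++ [top] := by simpa using e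
        obtain rfl : s = top := by simpa using (List.append_inj' e' rfl).2
        simp [game, kind] at hk
    · rintro l s (hl | ⟨u, a, hu, ha, e⟩) - hk t htf
      · by_cases hs : IsHole X s
        · rcases htf with ⟨-, h⟩ | ⟨l', s', h, hs', -, e⟩
          · exact (h s (by simp) hs).elim
          · have e' : l = l' ∧ s = s' ∧ t = leaf 𝓛 ρ Y (Arena.BP.subtree T l' s' h) := by
              simpa using List.append_inj' e rfl
            obtain ⟨rfl, rfl, rfl⟩ := e'
            exact Or.inr ⟨l, s, hl, hs, by simp [leaf, hY l s h hl hs]⟩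
        · rw [mem_fill_child (by simpa using hfree _ hl) hs] at htf
          exact Or.inl (hS.all l s hl (fun h => hs (append_singleton_mem_holeNodes.1 h).2)
            (fun h => hk ⟨(hkind hs).symm.trans h.1, h.2⟩) t htf)
      · have e' : l ++ [s] = (u ++ [a]) ++ [top] := by simpa using e
        obtain rfl : s = top := by simpa using (List.append_inj' e' rfl).2
        have := (hB.path _ htf).chain
        rw [List.isChain_append_cons_cons] at this
        exact this.2.1.2.elim
    · intro c hc hcS _
      by_cases hex : ∃ u s, u ++ [s, top] ∈ c.prefixes
      · obtain ⟨u, s, hu⟩ := hex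
        have e : u ++ [s, top] = (u ++ [s]) ++ [top] := by simp
        rw [e] at hu
        rw [CompletedPath.eq_fin_of_terminal hc hu fun t h => h.2]
        refine ⟨_, _, rfl, ?_⟩
        have : (game 𝓛 ρ F r).Ω top = 1 := by
          simp only [game, priority, succ, kind]
          exact if_pos ⟨trivial, trivial⟩
        rw [this]
        exact odd_one
      · have hcS' : c.prefixes ⊆ S := by
          intro l hl
          rcases hcS hl with h | ⟨u, s, -, -, rfl⟩
          · exact h
          · exact (hex ⟨u, s, hl⟩).elim
        have hno : ∀ l s, l ++ [s] ∈ c.prefixes → ¬ IsHole X s := by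
          rintro l s hl hs
          have hnt : ¬ (game 𝓛 ρ F r).Terminal s := by
            obtain ⟨p, rfl⟩ := hs
            have hX : X ∈ F.free := (free_or_binders (hT _ (hS.sub (hcS' hl)) _
              (List.mem_append_right _ (List.mem_singleton_self _)))).resolve_right
              (List.nodup_cons.1 hn.1).1
            exact fun h => h top ⟨hT _ (hS.sub (hcS' hl)) _ (by simp), Or.inl ⟨hX, Or.inr rfl⟩⟩
          obtain ⟨t, ht⟩ := CompletedPath.exists_child_of_not_terminal hc hl hnt
          exact hfree _ (hcS' ht) s (by simp) hs
        have hcF : ∀ l s, l ++ [s] ∈ c.prefixes → s ∈ states 𝓛 F ∧ ¬ IsHole X s := fun l s hl =>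
          ⟨hT _ (hS.sub (hcS' hl)) s (by simp), hno l s hl⟩
        refine (paritySet_congr hcF).1 (hS.win c ((isIn_congr hcF).2 hc) hcS' ?_)
        rintro l hl ⟨u, s, rfl, -, hs⟩
        exact hno u s hl hs

/-- The root is unfolded along a path of non-branching states, in which a state `⟨p, X⟩` can occur
only in the first place. -/
theorem exists_unfoldRoot_eq (hn : (fix b X F).IsNormal) (T : (game 𝓛 ρ (fix b X F) r).BP) :
    ∃ u s, ∃ h : u ++ [s] ∈ T.1, unfoldRoot 𝓛 ρ T = Arena.BP.subtree T u s h ∧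
      (∀ a ∈ u, (game 𝓛 ρ (fix b X F) r).kind a ≠ Kind.branching) ∧
      (∀ t, t <+: u → t ∉ holeNodes X 1) ∧ (u = [] → ¬ IsHole X s) := by
  by_cases h : ∃ u p, IsEntry b X F u ∧ u ++ [node p F] ∈ T.1
  · refine ⟨h.choose, node h.choose_spec.choose F, h.choose_spec.choose_spec.2, ?_⟩
    have he := h.choose_spec.choose_spec.1
    refine ⟨by rw [unfoldRoot, dif_pos h], ?_, ?_, ?_⟩
    · have hfix : ∀ p, kind (fix b X F) (node p (fix b X F) : State V L P) ≠ Kind.branching := by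
        intro p
        cases b <;> simp [kind]
      revert he
      generalize h.choose = u
      rintro (p | p | ⟨d, p⟩) a ha
      · obtain rfl := List.mem_singleton.1 ha
        exact kind_ne_branching_of_isHole ⟨p, rfl⟩ _
      · obtain rfl := List.mem_singleton.1 ha
        exact hfix p
      · simp only [List.mem_cons, List.not_mem_nil, or_false] at ha
        rcases ha with rfl | rfl
        · simp [game, kind]
        · exact hfix p
    · revert he
      generalize h.choose = u
      rintro he t htu ⟨v, a, rfl, hv, p, rfl⟩
      have hlen := htu.length_le
      have hmem := htu.subset (show node p (var X) ∈ v ++ [node p (var X)] by simp)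
      cases he with
      | var q =>
        simp only [List.length_append, List.length_cons, List.length_nil] at hlen
        omega
      | fix q => simp at hmem
      | distr d q => simp at hmem
    · intro h0
      rw [h0] at he
      cases he
  · obtain ⟨s, hs, -⟩ := T.2.root
    refine ⟨[], s, hs, ?_, by simp, ?_, ?_⟩
    · rw [unfoldRoot, dif_neg h, T.subtree_nil]
    · rintro t ht ⟨v, a, rfl, hv, -⟩
      have := ht.length_le
      simp at this
    · rintro - ⟨p, rfl⟩
      have hE : (game 𝓛 ρ (fix b X F) r).E (node p (var X)) (node p F) :=
        ⟨(T.2.path _ hs).mem _ (by simp), (mem_succ_hole_iff hn).2 rfl⟩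
      obtain ⟨t, ht, hT⟩ := exists_child T (l := []) hs
        (kind_ne_branching_of_isHole ⟨p, rfl⟩ (fix b X F)) hE
      obtain rfl := (mem_succ_hole_iff hn).1 ht.2
      exact h ⟨_, p, IsEntry.var p, hT⟩

/-- `T` belongs to `𝕎(Y)` iff Player 1 has a strategy tree in `T` itself which wins up to the first
non-root states `⟨p, X⟩` and reaches them only at subtrees in `Y`. -/
theorem mem_W_iff (hn : (fix b X F).IsNormal) (Y : Set (game 𝓛 ρ (fix b X F) r).BP)
    (T : (game 𝓛 ρ (fix b X F) r).BP) :
    T ∈ W 𝓛 ρ hn Y ↔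
      ∃ S, (game 𝓛 ρ (fix b X F) r).PartialWin T.1 (holeNodes X 1) S ∧
        ∀ l s (h : l ++ [s] ∈ T.1), l ++ [s] ∈ S → 1 ≤ l.length → IsHole X s →
          Arena.BP.subtree T l s h ∈ Y := by
  refine (playerOneWins_fill_iff hn Y _ (unfoldRoot_mem T) (m 𝓛 ρ hn Y T).2).trans ?_
  obtain ⟨u, s, h, hU, hk, hu, h0⟩ := exists_unfoldRoot_eq hn T
  rw [hU]
  have hnil : ∀ {w : List (State V L P)} {a}, (w ++ [a]).head? = some s → IsHole X a →
      1 ≤ (u ++ w).length := by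
    intro w a hw ha
    by_contra hlt
    have : u = [] ∧ w = [] := by
      simpa [Nat.lt_one_iff] using hlt
    obtain ⟨rfl, rfl⟩ := this
    obtain rfl : a = s := by simpa using hw
    exact h0 rfl ha
  have hcomp : ∀ {l}, l ∈ T.1 → l <+: u ++ [s] ∨ u ++ [s] <+: l := fun {l} hl =>
    T.comparable_of_forced h (by simpa using hk) hl
  constructor
  · rintro ⟨S, hS, hY⟩
    have hlow : ∀ l ∈ T.1, l.length ≤ u.length + 1 →
        l <+: u ∨ ∃ w ∈ S, l = u ++ w := by
      intro l hl hlen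
      have hl' : l <+: u ++ [s] := by
        rcases hcomp hl with h | h
        · exact h
        · exact (h.eq_of_length_le (by simpa using hlen)).symm ▸ List.prefix_rfl
      rcases List.prefix_concat_iff.1 hl' with rfl | h'
      · exact Or.inr ⟨[s], hS.root s ⟨rfl, h⟩, rfl⟩
      · exact Or.inl h'
    have last : ∀ {l a w}, w ∈ S → l ++ [a] = u ++ w → ∃ w', w = w' ++ [a] ∧ l = u ++ w' := by
      intro l a w hw e
      have hh := (hS.sub hw).1
      rcases List.eq_nil_or_concat' w with rfl | ⟨w, c, rfl⟩
      · simp at hh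
      · rw [← List.append_assoc] at e
        obtain ⟨h1, h2⟩ := List.append_inj' e rfl
        exact ⟨w, by rw [h2], h1⟩
    have hnot : ∀ {w a}, w ++ [a] ∈ S → (u ++ w) ++ [a] ∉ holeNodes X 1 →
        w ++ [a] ∉ holeNodes X 0 := by
      intro w a hw hst hst'
      have ha := (append_singleton_mem_holeNodes.1 hst').2
      exact hst (append_singleton_mem_holeNodes.2 ⟨hnil (hS.sub hw).1 ha, ha⟩)
    refine ⟨{l | l ∈ T.1 ∧ (l <+: u ∨ ∃ w ∈ S, l = u ++ w)},
      ⟨fun l hl => hl.1, ?_, ?_, ?_, ?_⟩, ?_⟩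
    · exact fun a ha => ⟨ha, hlow _ ha (by simp)⟩
    · rintro l a ⟨hl, hl' | ⟨w, hw, e⟩⟩ hst hka hp hterm
      · exact (hk a (hl'.subset (by simp)) hka).elim
      · obtain ⟨w, rfl, rfl⟩ := last hw e
        obtain ⟨t, ht⟩ := hS.choice w a hw (hnot hw hst) hka hp hterm
        have := (hS.sub ht).2
        exact ⟨t, by simpa using this, Or.inr ⟨_, ht, by simp⟩⟩
    · rintro l a ⟨hl, hl' | ⟨w, hw, e⟩⟩ hst hka t ht
      · refine ⟨ht, hlow _ ht ?_⟩
        have := hl'.length_le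
        simpa using this
      · obtain ⟨w, rfl, rfl⟩ := last hw e
        refine ⟨ht, Or.inr ⟨_, hS.all w a hw (hnot hw hst) hka t ⟨?_, by simpa using ht⟩, by simp⟩⟩
        have := (hS.sub hw).1
        cases w <;> simpa using this
    · intro c hc hcS hcs
      have hv : u ++ [s] ∈ c.prefixes := CompletedPath.mem_prefixes_of_comparable hc
        (T.2.path _ h) fun l hl => hcomp (hcS hl).1
      rw [← MetaParityGame.drop_mem_paritySet _ hv]
      have hdS : (c.drop u.length).prefixes ⊆ S := by
        intro w hw
        obtain ⟨hw0, hw⟩ := (CompletedPath.mem_prefixes_drop hv).1 hw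
        rcases (hcS hw).2 with h' | ⟨w', hw', e⟩
        · have := h'.length_le
          have := List.length_pos_iff.2 hw0
          simp only [List.length_append] at *
          omega
        · rwa [List.append_cancel_left e]
      refine hS.win _ (hc.drop hv) hdS ?_
      rintro w hw ⟨w, a, rfl, -, ha⟩
      refine hnot (hdS hw) ?_ (append_singleton_mem_holeNodes.2 ⟨Nat.zero_le _, ha⟩)
      have := hcs _ ((CompletedPath.mem_prefixes_drop hv).1 hw).2
      rwa [List.append_assoc]
    · rintro l a hl ⟨-, hl' | ⟨w, hw, e⟩⟩ h1 ha
      · exact (hu _ hl' (append_singleton_mem_holeNodes.2 ⟨h1, ha⟩)).elim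
      · obtain ⟨w, rfl, rfl⟩ := last hw e
        have := hY w a (hS.sub hw) hw ha
        rwa [T.subtree_subtree h (hS.sub hw) hl] at this
  · rintro ⟨S₀, hS₀, hY⟩
    obtain ⟨S, hSS, hS, ht⟩ := hS₀.exists_trimmed
    have huS : u ++ [s] ∈ S := hS.mem_of_forced h (by simpa using hk) (by simpa using hu)
    refine ⟨_, (hS.subtree ht h huS).mono ?_, ?_⟩
    · rintro w ⟨hw, -⟩ hst
      obtain ⟨w, a, rfl⟩ := (List.eq_nil_or_concat' w).resolve_left (by rintro rfl; simp at hw)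
      change u ++ (w ++ [a]) ∈ holeNodes X 1 at hst
      rw [← List.append_assoc] at hst
      exact append_singleton_mem_holeNodes.2
        ⟨Nat.zero_le _, (append_singleton_mem_holeNodes.1 hst).2⟩
    · rintro w a hw ⟨hwh, hwS⟩ ha
      have hwT : (u ++ w) ++ [a] ∈ T.1 := by simpa using hw.2
      rw [T.subtree_subtree h hw hwT]
      exact hY _ a hwT (hSS (by simpa using hwS)) (hnil hwh ha) ha

/-! ### The winning set as a fixed point -/

theorem W_mono (hn : (fix b X F).IsNormal) : Monotone (W 𝓛 ρ (r := r) hn) := by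
  intro Y Y' hY T hT
  rw [mem_W_iff] at hT ⊢
  obtain ⟨S, hS, h⟩ := hT
  exact ⟨S, hS, fun l s hl hlS h1 hs => hY (h l s hl hlS h1 hs)⟩

theorem mem_W_of_partialWin (hn : (fix b X F).IsNormal) {Y : Set (game 𝓛 ρ (fix b X F) r).BP}
    {T : (game 𝓛 ρ (fix b X F) r).BP} {S : Set (List (State V L P))}
    (hS : (game 𝓛 ρ (fix b X F) r).PartialWin T.1 ∅ S)
    (hY : ∀ l s (h : l ++ [s] ∈ T.1), l ++ [s] ∈ S → 1 ≤ l.length → IsHole X s →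
      Arena.BP.subtree T l s h ∈ Y) : T ∈ W 𝓛 ρ hn Y :=
  (mem_W_iff hn Y T).2 ⟨S, hS.mono fun _ _ h => h.elim, hY⟩

theorem Φ_le_W_Φ (hn : (fix b X F).IsNormal) :
    (game 𝓛 ρ (fix b X F) r).Φ ≤ W 𝓛 ρ hn (game 𝓛 ρ (fix b X F) r).Φ := by
  intro T hT
  obtain ⟨S₀, hS₀⟩ := (MetaParityGame.mem_Φ_iff T).1 hT
  obtain ⟨S, -, hS, ht⟩ := hS₀.exists_trimmed
  exact mem_W_of_partialWin hn hS fun l s h hl _ _ => hS.subtree_mem_Φ ht h hl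

/-- Player 1 follows a strategy up to the first non-root state `⟨p, X⟩`, and then switches to a
winning strategy of the subtree reached. -/
theorem W_Φ_le_Φ (hn : (fix b X F).IsNormal) :
    W 𝓛 ρ hn (game 𝓛 ρ (fix b X F) r).Φ ≤ (game 𝓛 ρ (fix b X F) r).Φ := by
  intro T hT
  obtain ⟨S₀, hS₀, hΦ₀⟩ := (mem_W_iff hn _ T).1 hT
  obtain ⟨S, hSS, hS, ht⟩ := hS₀.exists_trimmed
  refine MetaParityGame.playerOneWins_of_cut T ({l | l.length = 1} ∪ (S ∩ holeNodes X 1))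
    (fun s _ => Or.inl rfl) ?_ ?_
  · rintro u s h (hu | ⟨huS, hu⟩)
    · obtain rfl : u = [] := by simpa using hu
      rw [T.subtree_nil]
      refine ⟨S, hS.mono fun l hl hst => ⟨?_, Or.inr ⟨hl, hst⟩⟩⟩
      obtain ⟨v, a, rfl, hv, -⟩ := hst
      simpa using hv
    · obtain ⟨h1, hs⟩ := append_singleton_mem_holeNodes.1 hu
      obtain ⟨S', hS'⟩ := (MetaParityGame.mem_Φ_iff _).1 (hΦ₀ u s h (hSS huS) h1 hs)
      exact ⟨S', hS'.mono fun _ _ h => h.elim⟩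
  · -- A play passes through at most two cut nodes: its root and the first `⟨p, X⟩` after it.
    intro c hc _ h
    obtain ⟨u, hu, huC, h1⟩ := h 1
    obtain ⟨v, hv, hvC, h2⟩ := h u.length
    rcases huC with huC | ⟨-, huC⟩
    · have h3 : u.length = 1 := huC
      omega
    rcases hvC with hvC | ⟨hvS, -⟩
    · have h3 : v.length = 1 := hvC
      omega
    have := ht.maximal v hvS u huC (CompletedPath.ne_nil_of_mem_prefixes hu)
      (CompletedPath.prefix_of_length_le hu hv h2.le)
    exact absurd (congrArg List.length this) (by omega)

/-- If `r X` is even, Player 1 wins by switching, at each state `⟨p, X⟩`, to a strategy tree of the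
subtree reached, which leads to further members of `Y` only. -/
theorem le_Φ_of_le_W (hn : (fix b X F).IsNormal) (hr : (fix b X F).IsPriority r) (hX : Even (r X))
    {Y : Set (game 𝓛 ρ (fix b X F) r).BP} (hY : Y ≤ W 𝓛 ρ hn Y) :
    Y ≤ (game 𝓛 ρ (fix b X F) r).Φ := by
  intro T hT
  refine MetaParityGame.playerOneWins_of_cut T
    {l | ∃ u s, ∃ h : u ++ [s] ∈ T.1, l = u ++ [s] ∧ (u = [] ∨ IsHole X s) ∧
      Arena.BP.subtree T u s h ∈ Y} ?_ ?_ ?_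
  · exact fun s hs => ⟨[], s, hs, rfl, Or.inl rfl, by rwa [T.subtree_nil]⟩
  · rintro u s h ⟨u', s', h', e, -, hu⟩
    obtain ⟨rfl, e'⟩ := List.append_inj' e rfl
    obtain rfl : s = s' := by simpa using e'
    obtain ⟨S, hS, hSY⟩ := (mem_W_iff hn Y _).1 (hY hu)
    refine ⟨S, hS.mono ?_⟩
    rintro w hw ⟨w, a, rfl, h1, ha⟩
    have hwT := hS.sub hw
    have hwT' : (u ++ w) ++ [a] ∈ T.1 := by simpa using hwT.2
    have := hSY w a hwT hw h1 ha
    rw [T.subtree_subtree h hwT hwT'] at this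
    exact ⟨by simpa using h1, u ++ w, a, hwT', by simp, Or.inr ha, this⟩
  · intro c hc _ h
    refine (mem_paritySet_of_holes hn hr hc fun n => ?_).2 hX
    obtain ⟨v, hv, ⟨u, s, -, rfl, hs, -⟩, hl⟩ := h (n + 1)
    refine ⟨_, hv, append_singleton_mem_holeNodes.2 ⟨Nat.zero_le _, hs.resolve_left ?_⟩, by omega⟩
    rintro rfl
    simp at hl

/-- If `r X` is odd, a branching play won by Player 1 but outside `Y` would contain a play which
follows a winning strategy and passes through infinitely many states `⟨p, X⟩`. -/
theorem Φ_le_of_W_le (hn : (fix b X F).IsNormal) (hr : (fix b X F).IsPriority r) (hX : Odd (r X))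
    {Y : Set (game 𝓛 ρ (fix b X F) r).BP} (hY : W 𝓛 ρ hn Y ≤ Y) :
    (game 𝓛 ρ (fix b X F) r).Φ ≤ Y := by
  intro T hT
  by_contra hTY
  obtain ⟨S₀, hS₀⟩ := (MetaParityGame.mem_Φ_iff T).1 hT
  obtain ⟨S, -, hS, ht⟩ := hS₀.exists_trimmed
  let N := {l : List (State V L P) // l ∈ S ∧ ∃ u s, ∃ h : u ++ [s] ∈ T.1, l = u ++ [s] ∧
    Arena.BP.subtree T u s h ∉ Y}
  have step : ∀ l : N, ∃ l' : N, l.1 <+: l'.1 ∧ l.1.length < l'.1.length ∧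
      l'.1 ∈ holeNodes X 0 := by
    rintro ⟨_, hl, u, s, h, rfl, hu⟩
    by_contra hno
    refine hu (hY (mem_W_of_partialWin hn
      ((hS.subtree ht h hl).mono (Stop' := ∅) fun _ _ h => h) ?_))
    rintro w a hw ⟨hwh, hwS⟩ h1 ha
    by_contra hwY
    have hwT : (u ++ w) ++ [a] ∈ T.1 := by simpa using hw.2
    rw [T.subtree_subtree h hw hwT] at hwY
    refine hno ⟨⟨(u ++ w) ++ [a], by simpa using hwS, u ++ w, a, hwT, rfl, hwY⟩, ?_, ?_,
      append_singleton_mem_holeNodes.2 ⟨Nat.zero_le _, ha⟩⟩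
    · cases w with
      | nil => simp at h1
      | cons c w =>
        obtain rfl : c = s := by simpa using hwh
        exact ⟨w ++ [a], by simp⟩
    · simp only [List.length_append, List.length_singleton]
      omega
  choose next h1 h2 h3 using step
  obtain ⟨s₀, hs₀, -⟩ := T.2.root
  let l₀ : N := ⟨[s₀], hS.root s₀ hs₀, [], s₀, hs₀, rfl, by rwa [T.subtree_nil]⟩
  let f : ℕ → N := fun n => next^[n] l₀
  have hf : ∀ n, f (n + 1) = next (f n) := fun n => Function.iterate_succ_apply' next n l₀
  have hlen : ∀ n, (f n).1.length < (f (n + 1)).1.length := fun n => hf n ▸ h2 (f n)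
  obtain ⟨x, hx, hx'⟩ := CompletedPath.exists_inf_of_prefix_chain (fun n => (f n).1)
    (fun n => hf n ▸ h1 (f n)) hlen
  have hxS : (CompletedPath.inf x).prefixes ⊆ S := by
    intro u hu
    obtain ⟨n, hn⟩ := hx' u hu
    exact ht.closed _ (f n).2.1 u (CompletedPath.ne_nil_of_mem_prefixes hu) hn
  have hc : (CompletedPath.inf x).IsIn (game 𝓛 ρ (fix b X F) r).toArena :=
    CompletedPath.isIn_inf_iff.2 fun u hu => T.2.path u (hS.sub (hxS hu))
  refine Nat.not_even_iff_odd.2 hX ((mem_paritySet_of_holes hn hr hc fun n => ?_).1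
    (hS.win _ hc hxS fun _ _ h => h))
  refine ⟨(f (n + 1)).1, hx _ ?_, hf n ▸ h3 (f n), ?_⟩
  · exact (T.2.path _ (hS.sub (f (n + 1)).2.1)).ne_nil
  · have : StrictMono fun n => (f n).1.length := strictMono_nat_of_lt_succ hlen
    exact this.le_apply (x := n + 1)

end Game

end PLMu

theorem theorem6p5 {V L P : Type*} [Countable L] [Countable P] (𝓛 : PLMu.PLTS L P)
    (ρ : V → P → unitInterval) (X : V) (F : PLMu.Formula V L) (r : V → ℕ) :
    (∀ hn : (PLMu.Formula.fix PLMu.Binder.mu X F).IsProductNormal,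
      (PLMu.Formula.fix PLMu.Binder.mu X F).IsPriority r →
      Monotone (PLMu.W 𝓛 ρ (r := r) hn.1) ∧
      IsLeast (Function.fixedPoints (PLMu.W 𝓛 ρ (r := r) hn.1))
        (PLMu.game 𝓛 ρ (PLMu.Formula.fix PLMu.Binder.mu X F) r).Φ) ∧
    (∀ hn : (PLMu.Formula.fix PLMu.Binder.nu X F).IsProductNormal,
      (PLMu.Formula.fix PLMu.Binder.nu X F).IsPriority r →
      Monotone (PLMu.W 𝓛 ρ (r := r) hn.1) ∧
      IsGreatest (Function.fixedPoints (PLMu.W 𝓛 ρ (r := r) hn.1))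
        (PLMu.game 𝓛 ρ (PLMu.Formula.fix PLMu.Binder.nu X F) r).Φ) := by
  refine ⟨fun hn hr => ⟨PLMu.W_mono hn.1, ?_, fun Y hY => ?_⟩,
    fun hn hr => ⟨PLMu.W_mono hn.1, ?_, fun Y hY => ?_⟩⟩
  · exact le_antisymm (PLMu.W_Φ_le_Φ hn.1) (PLMu.Φ_le_W_Φ hn.1)
  · exact PLMu.Φ_le_of_W_le hn.1 hr (hr.odd X F (PLMu.Formula.mem_Sub_self _)) hY.le
  · exact le_antisymm (PLMu.W_Φ_le_Φ hn.1) (PLMu.Φ_le_W_Φ hn.1)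
  · exact PLMu.le_Φ_of_le_W hn.1 hr (hr.even X F (PLMu.Formula.mem_Sub_self _)) hY.ge
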